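/- Let $\beta,\gamma\ge 1$ be integers and let $A\in\mathbb C^{n\times n}$ be banded with upper bandwidth $\beta$ and lower bandwidth $\gamma$, that is, $A_{k\ell}=0$ whenever $\ell-k>\beta$ or $k-\ell>\gamma$. Put $$\xi=\xi(k,\ell)=\begin{cases}\lceil(\ell-k)/\beta\rceil,&k<\ell,\\ \lceil(k-\ell)/\gamma\rceil,&k\ge\ell.\end{cases}$$ Suppose that the field of values $W(A)=\{v^*Av : v\in\mathbb C^n,\ \|v\|=1\}$ ($\|\cdot\|$ the Euclidean norm) is contained in a closed region $E$ bounded by a horizontal ellipse with semi-axes $a\ge b>0$ ($a$ horizontal, $b$ vertical) and center $c\in\mathbb C$, and that $E\subset\{z:\operatorname{Re}z>0\}$. All complex square roots are principal, and $$A^{-1/2}=\frac1{2\pi i}\int_\Gamma \frac1{\sqrt z}\,(zI-A)^{-1}\,dz,$$ where $\Gamma\subset\mathbb C\setminus(-\infty,0]$ is a system of closed curves encircling each eigenvalue of $A$ exactly once in the positive sense (such $\Gamma$ exist). Then, for every real $\varepsilon$ with $0<\varepsilon\le|c|-\sqrt{a(a+b)}$ and all $k,\ell\in\{1,\dots,n\}$,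 $$\left|\left(A^{-1/2}\right)_{k\ell}\right|\le\frac{2}{\sqrt\varepsilon}\,q_2(a,b,c,\varepsilon)\left(\frac{a+b}{|c|-\varepsilon}\cdot\frac{1}{\left|1+\sqrt{1-(a^2-b^2)/(c(1-\varepsilon/|c|))^2}\right|}\right)^{\xi},$$ where $$q_2(a,b,c,\varepsilon)=\frac{\left|c(1-\varepsilon/|c|)+\sqrt{c^2(1-\varepsilon/|c|)^2-(a^2-b^2)}\right|}{\left|c(1-\varepsilon/|c|)+\sqrt{c^2(1-\varepsilon/|c|)^2-(a^2-b^2)}\right|-(a+b)}.$$ Moreover, the denominator of $q_2$ is positive and the quantity raised to the power $\xi$ is smaller than $1$, so that the bound decays exponentially in $\xi$. -/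

import Mathlib

open scoped Matrix

noncomputable section

namespace MatrixDecay

/-- A finite system of closed curves in the complex plane, each parametrized over `[0, 1]` by a
continuously differentiable map. The derivative may vanish, so that every closed piecewise `C^1`
curve, in particular every piecewise `C^1` Jordan curve, can be parametrized in this way. -/
structure Contour where
  /-- the number of curves -/
  size : ℕ
  /-- the parametrizations -/
  curve : Fin size → ℝ → ℂ
  contDiffOn : ∀ i, ContDiffOn ℝ 1 (curve i) (Set.Icc 0 1)
  closed : ∀ i, curve i 0 = curve i 1

/-- The set of all points on the curves. -/
def Contour.trace (Γ : Contour) : Set ℂ :=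
  ⋃ i, Γ.curve i '' Set.Icc 0 1

/-- The contour integral `∫_Γ g(z) dz`. -/
def Contour.integral (Γ : Contour) (g : ℂ → ℂ) : ℂ :=
  ∑ i, ∫ t in (0 : ℝ)..1, g (Γ.curve i t) * deriv (Γ.curve i) t

/-- The (total) winding number of `Γ` about a point `w` off its trace. -/
def Contour.windingNumber (Γ : Contour) (w : ℂ) : ℂ :=
  (2 * Real.pi * Complex.I)⁻¹ * Γ.integral (fun z => (z - w)⁻¹)

/-- `Γ` lies in `Ω` and encircles each point of `K` exactly once in the positive sense, without
encircling any point outside `Ω`. -/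
def Contour.Encircles (Γ : Contour) (Ω K : Set ℂ) : Prop :=
  Γ.trace ⊆ Ω \ K ∧ (∀ w ∈ K, Γ.windingNumber w = 1) ∧ (∀ w ∉ Ω, Γ.windingNumber w = 0)

/-- `X = f(A) = (2πi)⁻¹ ∫_Γ f(z) (zI - A)⁻¹ dz`, for `f` analytic on the open set `Ω` and some
contour `Γ` in `Ω` encircling each eigenvalue of `A` exactly once. -/
def IsMatrixFunction {n : ℕ} (f : ℂ → ℂ) (Ω : Set ℂ) (A X : Matrix (Fin n) (Fin n) ℂ) : Prop :=
  IsOpen Ω ∧ DifferentiableOn ℂ f Ω ∧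
    ∃ Γ : Contour, Γ.Encircles Ω (spectrum ℂ A) ∧
      ∀ k l, X k l = (2 * Real.pi * Complex.I)⁻¹ *
        Γ.integral (fun z => f z * ((z • (1 : Matrix (Fin n) (Fin n) ℂ) - A)⁻¹) k l)

/-- `X = A^{-1/2}`: the matrix function for `f(z) = (√z)⁻¹` with the principal square root, analytic
on `ℂ \ (-∞, 0]`. -/
def IsInvSqrt {n : ℕ} (A X : Matrix (Fin n) (Fin n) ℂ) : Prop :=
  IsMatrixFunction (fun z => (Complex.sqrt z)⁻¹) Complex.slitPlane A X

/-- The field of values `W(A) = {v* A v | ‖v‖ = 1}`, with the Euclidean norm. -/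
def fieldOfValues {n : ℕ} (A : Matrix (Fin n) (Fin n) ℂ) : Set ℂ :=
  {w | ∃ v : EuclideanSpace ℂ (Fin n), ‖v‖ = 1 ∧ w = star v.ofLp ⬝ᵥ (A *ᵥ v.ofLp)}

/-- Banded matrices with upper bandwidth `β` and lower bandwidth `γ`. -/
def IsBanded {n : ℕ} (β γ : ℕ) (A : Matrix (Fin n) (Fin n) ℂ) : Prop :=
  ∀ k l : Fin n, ((l : ℤ) - (k : ℤ) > β ∨ (k : ℤ) - (l : ℤ) > γ) → A k l = 0

/-- `⌈(l - k)/β⌉` if `k < l`, and `⌈(k - l)/γ⌉` if `k ≥ l`. -/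
def xi {n : ℕ} (β γ : ℕ) (k l : Fin n) : ℕ :=
  if k < l then ⌈(((l : ℕ) : ℚ) - ((k : ℕ) : ℚ)) / (β : ℚ)⌉₊
  else ⌈(((k : ℕ) : ℚ) - ((l : ℕ) : ℚ)) / (γ : ℚ)⌉₊

/-- The closed region bounded by the horizontal ellipse with centre `c`, horizontal semi-axis `a`
and vertical semi-axis `b`. -/
def ellipseRegion (a b : ℝ) (c : ℂ) : Set ℂ :=
  {z | ((z.re - c.re) / a) ^ 2 + ((z.im - c.im) / b) ^ 2 ≤ 1}

/-- `|c(1 - ε/|c|) + √(c²(1 - ε/|c|)² - (a² - b²))|`. -/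
def levelRadius (a b : ℝ) (c : ℂ) (ε : ℝ) : ℝ :=
  ‖c * (1 - ε / ‖c‖) + Complex.sqrt (c ^ 2 * (1 - ε / ‖c‖) ^ 2 - (a ^ 2 - b ^ 2))‖

/-- The factor `q₂(a, b, c, ε)`. -/
def q₂ (a b : ℝ) (c : ℂ) (ε : ℝ) : ℝ :=
  levelRadius a b c ε / (levelRadius a b c ε - (a + b))

/-- `(a + b)/(|c| - ε) · 1/|1 + √(1 - (a² - b²)/(c(1 - ε/|c|))²)|`. -/
def rate (a b : ℝ) (c : ℂ) (ε : ℝ) : ℝ :=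
  (a + b) / (‖c‖ - ε) *
    (1 / ‖1 + Complex.sqrt (1 - (a ^ 2 - b ^ 2) / (c * (1 - ε / ‖c‖)) ^ 2)‖)

end MatrixDecay

end

namespace MatrixDecay

open Set MeasureTheory

/-! ### Elementary properties of contour integrals. -/

namespace Contour

/-! Put R = (a+b)/2, κ = (a-b)/(a+b) ∈ [0,1) and M = (A-c)/R. The map z = c + R(w + κ/w) carries |w|
= 1 onto the boundary of E, and for j ≥ 1 the Faber polynomials of E are the Dickson polynomials
D_j, with D_j(w + κ/w) = w^j + (κ/w)^j, evaluated at (z-c)/R.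

Boundedness: the generating function (1-κu²)(1-uM+κu²)⁻¹ = 1 + Σ_{j≥1} u^j D_j(M) has positive
semidefinite real part for |u| < 1, because W(A) lies in E. Carathéodory's coefficient inequality
then bounds every entry of D_j(M) by 2 (`norm_aeval_dickson_le`).

Expansion: let w₁, w₂ be the preimages of the branch point 0, with w₁w₂ = κ and |w₁| > 1. Then z =
-R w₁ (1 - w/w₁)(1 - w₂/w), so z^(-1/2) is a constant of modulus (R|w₁|)^(-1/2) times two binomial
series with coefficients of modulus at most 1. Pairing the term (p,q) with (q,p) produces w₁^(-p-q)
κ^min(p,q) D_|p-q| (`mul_eval_dickson`). Integration against the resolvent over the ellipse |w| = r,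
1 < r < |w₁|, gives a series for A^(-1/2) in the D_j(M); by `exists_eq_resolventIntegral` every
admissible contour gives the same matrix.

Decay: D_j(M) is banded with bandwidths jβ, jγ, so only terms with |p-q| ≥ ξ contribute at (k,l).
With σ = 1/|w₁| they add up to at most |C|·2σ^ξ/((1-σ)(1-κσ²)), where |C| = (R|w₁|)^(-1/2).

Comparison: the rate in the theorem is 1/|u₁|, where u₁ is the exterior preimage of c(1-ε/|c|)/R
under w + κ/w. Shrinking c shrinks the confocal ellipse through it, so |u₁| ≤ |w₁|; `sub_le_mul_sq`
turns the remaining constant into 1/√ε. -/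

theorem curve_mem_trace (Γ : Contour) (i : Fin Γ.size) {t : ℝ} (ht : t ∈ Icc (0 : ℝ) 1) :
    Γ.curve i t ∈ Γ.trace :=
  mem_iUnion.2 ⟨i, mem_image_of_mem _ ht⟩

/-- Curves are regular only relative to [0,1], so `deriv` is controlled only in the interior. The
endpoints have measure zero, and `derivWithin` is the continuous representative. -/
theorem deriv_eq_derivWithin (γ : ℝ → ℂ) :
    ∀ t ∈ Ioo (0 : ℝ) 1, derivWithin γ (Icc 0 1) t = deriv γ t := fun _ ht =>
  derivWithin_of_mem_nhds (Icc_mem_nhds ht.1 ht.2)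

theorem intervalIntegrable (Γ : Contour) (i : Fin Γ.size) {g : ℂ → ℂ}
    (hg : ContinuousOn g Γ.trace) :
    IntervalIntegrable (fun t => g (Γ.curve i t) * deriv (Γ.curve i) t) volume 0 1 := by
  have h1 : ContinuousOn (fun t => g (Γ.curve i t) * derivWithin (Γ.curve i) (Icc 0 1) t)
      (Icc 0 1) :=
    (hg.comp (Γ.contDiffOn i).continuousOn fun t ht => Γ.curve_mem_trace i ht).mul
      ((Γ.contDiffOn i).continuousOn_derivWithin (uniqueDiffOn_Icc zero_lt_one) le_rfl)
  have h2 := h1.intervalIntegrable_of_Icc (μ := volume) zero_le_one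
  rw [intervalIntegrable_iff_integrableOn_Ioo_of_le zero_le_one] at h2 ⊢
  refine h2.congr_fun (fun t ht => ?_) measurableSet_Ioo
  simp only [deriv_eq_derivWithin _ t ht]

theorem integral_congr (Γ : Contour) {g h : ℂ → ℂ} (hgh : ∀ z ∈ Γ.trace, g z = h z) :
    Γ.integral g = Γ.integral h := by
  refine Finset.sum_congr rfl fun i _ => intervalIntegral.integral_congr fun t ht => ?_
  rw [uIcc_of_le zero_le_one] at ht
  simp only [hgh _ (Γ.curve_mem_trace i ht)]

theorem integral_add (Γ : Contour) {g h : ℂ → ℂ} (hg : ContinuousOn g Γ.trace)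
    (hh : ContinuousOn h Γ.trace) :
    Γ.integral (fun z => g z + h z) = Γ.integral g + Γ.integral h := by
  simp only [integral, add_mul]
  rw [← Finset.sum_add_distrib]
  exact Finset.sum_congr rfl fun i _ =>
    intervalIntegral.integral_add (Γ.intervalIntegrable i hg) (Γ.intervalIntegrable i hh)

theorem integral_const_mul (Γ : Contour) (a : ℂ) (g : ℂ → ℂ) :
    Γ.integral (fun z => a * g z) = a * Γ.integral g := by
  simp only [integral, mul_assoc, intervalIntegral.integral_const_mul, Finset.mul_sum]

theorem integral_sub (Γ : Contour) {g h : ℂ → ℂ} (hg : ContinuousOn g Γ.trace)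
    (hh : ContinuousOn h Γ.trace) :
    Γ.integral (fun z => g z - h z) = Γ.integral g - Γ.integral h := by
  have := Γ.integral_add hg (h := fun z => -1 * h z) (continuousOn_const.mul hh)
  rw [integral_const_mul] at this
  simpa [sub_eq_add_neg] using this

theorem integral_zero (Γ : Contour) : Γ.integral (fun _ => 0) = 0 := by
  simp [integral]

theorem integral_finset_sum (Γ : Contour) {ι : Type*} (s : Finset ι) {g : ι → ℂ → ℂ}
    (hg : ∀ i ∈ s, ContinuousOn (g i) Γ.trace) :
    Γ.integral (fun z => ∑ i ∈ s, g i z) = ∑ i ∈ s, Γ.integral (g i) := by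
  classical
  induction s using Finset.induction_on with
  | empty => simp [integral_zero]
  | insert a s ha ih =>
    simp only [Finset.sum_insert ha]
    rw [integral_add _ (hg a (by simp)) (continuousOn_finsetSum _ fun i hi => hg i (by simp [hi])),
      ih fun i hi => hg i (by simp [hi])]

theorem integral_eq_zero_of_primitive (Γ : Contour) {F g : ℂ → ℂ}
    (hF : ∀ z ∈ Γ.trace, HasDerivAt F (g z) z) (hg : ContinuousOn g Γ.trace) :
    Γ.integral g = 0 := by
  refine Finset.sum_eq_zero fun i _ => ?_
  rw [intervalIntegral.integral_eq_sub_of_hasDerivAt_of_le (f := fun t => F (Γ.curve i t))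
    zero_le_one ?_ ?_ (Γ.intervalIntegrable i hg), Γ.closed i, sub_self]
  · intro t ht
    exact ((hF _ (Γ.curve_mem_trace i ht)).continuousAt.comp_continuousWithinAt
      ((Γ.contDiffOn i).continuousOn t ht))
  · intro t ht
    have h1 : DifferentiableAt ℝ (Γ.curve i) t :=
      (((Γ.contDiffOn i).differentiableOn one_ne_zero) t (Ioo_subset_Icc_self ht)).differentiableAt
        (Icc_mem_nhds ht.1 ht.2)
    exact (hF _ (Γ.curve_mem_trace i (Ioo_subset_Icc_self ht))).comp t h1.hasDerivAt

end Contour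

/-! ### The principal square root and primitives on the slit plane. -/

theorem sqrt_sq (z : ℂ) : Complex.sqrt z ^ 2 = z := by
  rw [Complex.sqrt, ← Complex.cpow_nat_mul]; simp

theorem sqrt_re_nonneg (z : ℂ) : 0 ≤ (Complex.sqrt z).re := by
  rcases eq_or_ne z 0 with rfl | hz
  · simp [Complex.sqrt]
  · rw [Complex.sqrt, Complex.cpow_def_of_ne_zero hz, Complex.exp_re]
    refine mul_nonneg (Real.exp_pos _).le (Real.cos_nonneg_of_mem_Icc ?_)
    have h : (Complex.log z * 2⁻¹).im = z.arg / 2 := by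
      have : (2⁻¹ : ℂ) = ((1 / 2 : ℝ) : ℂ) := by norm_num
      rw [this, Complex.im_mul_ofReal, Complex.log_im]; ring
    rw [h]
    constructor <;> linarith [Complex.neg_pi_lt_arg z, Complex.arg_le_pi z]

theorem sqrt_re_pos {z : ℂ} (hz : z ∈ Complex.slitPlane) : 0 < (Complex.sqrt z).re := by
  refine lt_of_le_of_ne (sqrt_re_nonneg z) fun h => ?_
  have h2 := sqrt_sq z
  rw [Complex.mem_slitPlane_iff] at hz
  have hre := congrArg Complex.re h2
  have him := congrArg Complex.im h2
  simp only [sq, Complex.mul_re, Complex.mul_im, ← h] at hre him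
  rcases hz with hz | hz
  · nlinarith [sq_nonneg (Complex.sqrt z).im]
  · exact hz (by linarith)

theorem hasDerivAt_sqrt {z : ℂ} (hz : z ∈ Complex.slitPlane) :
    HasDerivAt Complex.sqrt (1 / (2 * Complex.sqrt z)) z := by
  have h0 : Complex.sqrt z ≠ 0 := fun h => by simpa [h] using sqrt_re_pos hz
  have h1 : HasDerivAt Complex.sqrt (2⁻¹ * z ^ ((2⁻¹ : ℂ) - 1) * 1) z :=
    (hasDerivAt_id z).cpow_const hz
  convert h1 using 1
  rw [Complex.cpow_sub _ _ (Complex.slitPlane_ne_zero hz), Complex.cpow_one, ← Complex.sqrt]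
  have := sqrt_sq z
  have hz0 := Complex.slitPlane_ne_zero hz
  field_simp
  linear_combination -this

/-- A holomorphic function on the slit plane has a primitive, since the slit plane is the image of
the unit disc under `u ↦ ((1 + u) / (1 - u)) ^ 2`. -/
theorem exists_primitive_slitPlane {g : ℂ → ℂ} (hg : DifferentiableOn ℂ g Complex.slitPlane) :
    ∃ F : ℂ → ℂ, ∀ z ∈ Complex.slitPlane, HasDerivAt F (g z) z := by
  have hne : ∀ u ∈ Metric.ball (0 : ℂ) 1, 1 - u ≠ 0 := fun u hu h => by
    rw [sub_eq_zero] at h; simp [← h] at hu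
  have hmem : ∀ u ∈ Metric.ball (0 : ℂ) 1, ((1 + u) / (1 - u)) ^ 2 ∈ Complex.slitPlane := by
    intro u hu
    have hre : 0 < ((1 + u) / (1 - u)).re := by
      have h1 : 0 < Complex.normSq (1 - u) := Complex.normSq_pos.2 (hne u hu)
      rw [Complex.div_re, ← add_div]
      refine div_pos ?_ h1
      have h2 : Complex.normSq u < 1 := by
        rw [Complex.normSq_eq_norm_sq]
        have : ‖u‖ < 1 := by simpa using hu
        nlinarith [norm_nonneg u]
      rw [Complex.normSq_apply] at h2
      simp
      nlinarith
    generalize (1 + u) / (1 - u) = v at hre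
    rw [Complex.mem_slitPlane_iff, sq, Complex.mul_re, Complex.mul_im]
    by_cases h : v.im = 0
    · left; rw [h]; nlinarith
    · right
      have := mul_ne_zero hre.ne' h
      intro h'; apply this; linarith
  have hd : ∀ u ∈ Metric.ball (0 : ℂ) 1,
      HasDerivAt (fun u : ℂ => ((1 + u) / (1 - u)) ^ 2) (4 * (1 + u) / (1 - u) ^ 3) u := by
    intro u hu
    have h := (((hasDerivAt_id u).const_add 1).div ((hasDerivAt_id u).const_sub 1)
      (hne u hu)).pow 2
    refine h.congr_deriv ?_
    have := hne u hu
    simp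
    field_simp
    ring
  have hG : DifferentiableOn ℂ
      (fun u : ℂ => g (((1 + u) / (1 - u)) ^ 2) * (4 * (1 + u) / (1 - u) ^ 3))
      (Metric.ball 0 1) := by
    refine (hg.comp (fun u hu => (hd u hu).differentiableAt.differentiableWithinAt) hmem).mul ?_
    intro u hu
    have h3 : (1 - u) ^ 3 ≠ 0 := pow_ne_zero 3 (hne u hu)
    have h4 : DifferentiableAt ℂ (fun u : ℂ => 4 * (1 + u) / (1 - u) ^ 3) u :=
      DifferentiableAt.div (by fun_prop) (by fun_prop) h3
    exact h4.differentiableWithinAt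
  -- The pulled-back differential has a primitive on the disc; it is carried back by the inverse map
  -- z ↦ (√z - 1)/(√z + 1).
  obtain ⟨H, hH⟩ := hG.isExactOn_ball
  refine ⟨fun z => H ((Complex.sqrt z - 1) / (Complex.sqrt z + 1)), fun z hz => ?_⟩
  have hs := sqrt_re_pos hz
  have hs0 : Complex.sqrt z ≠ 0 := fun h => by simp [h] at hs
  have hs1 : Complex.sqrt z + 1 ≠ 0 := fun h => by
    have := congrArg Complex.re h; simp at this; linarith
  have hball : (Complex.sqrt z - 1) / (Complex.sqrt z + 1) ∈ Metric.ball (0 : ℂ) 1 := by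
    rw [mem_ball_zero_iff, norm_div, div_lt_one (norm_pos_iff.2 hs1),
      ← sq_lt_sq₀ (norm_nonneg _) (norm_nonneg _), ← Complex.normSq_eq_norm_sq,
      ← Complex.normSq_eq_norm_sq, Complex.normSq_apply, Complex.normSq_apply]
    simp
    nlinarith
  have h1 := ((hasDerivAt_sqrt hz).sub_const 1).div ((hasDerivAt_sqrt hz).add_const 1) hs1
  have h2 := (hH _ hball).comp z h1
  refine h2.congr_deriv ?_
  have e1 : (1 + (Complex.sqrt z - 1) / (Complex.sqrt z + 1)) /
      (1 - (Complex.sqrt z - 1) / (Complex.sqrt z + 1)) = Complex.sqrt z := by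
    have : (1 - (Complex.sqrt z - 1) / (Complex.sqrt z + 1)) ≠ 0 := hne _ hball
    field_simp
    ring
  have e2 : 1 - (Complex.sqrt z - 1) / (Complex.sqrt z + 1) = 2 / (Complex.sqrt z + 1) := by
    field_simp; ring
  beta_reduce
  rw [e1, sqrt_sq, e2]
  field_simp
  ring

theorem Contour.integral_eq_zero_of_differentiableOn (Γ : Contour) {g : ℂ → ℂ}
    (hΓ : Γ.trace ⊆ Complex.slitPlane) (hg : DifferentiableOn ℂ g Complex.slitPlane) :
    Γ.integral g = 0 := by
  obtain ⟨F, hF⟩ := exists_primitive_slitPlane hg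
  exact Γ.integral_eq_zero_of_primitive (fun z hz => hF z (hΓ hz)) (hg.continuousOn.mono hΓ)

end MatrixDecay

namespace MatrixDecay

open Set MeasureTheory

theorem two_pi_I_ne_zero : (2 * Real.pi * Complex.I : ℂ) ≠ 0 := Complex.two_pi_I_ne_zero

/-! ### Integrals of reciprocal products. -/

section Winding

variable {Γ : Contour} {K : Set ℂ}

theorem continuousOn_inv_multiset_prod (hΓ : Disjoint Γ.trace K) (s : Multiset ℂ)
    (hs : ∀ x ∈ s, x ∈ K) :
    ContinuousOn (fun z => ((s.map (fun x => z - x)).prod)⁻¹) Γ.trace := by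
  refine ContinuousOn.inv₀ ?_ fun z hz h => ?_
  · exact (continuous_multiset_prod (f := fun x z => z - x) s
      (fun x _ => by fun_prop)).continuousOn
  · rw [Multiset.prod_eq_zero_iff, Multiset.mem_map] at h
    obtain ⟨x, hx, hzx⟩ := h
    rw [sub_eq_zero] at hzx
    exact hΓ.ne_of_mem hz (hs x hx) hzx

/-- If every point of `K` has winding number one, then the reciprocal of a product of at least two
factors `z - x` with `x ∈ K` integrates to zero. -/
theorem integral_inv_multiset_prod_eq_zero (hΓ : Disjoint Γ.trace K)
    (hw : ∀ x ∈ K, Γ.windingNumber x = 1) (m : ℕ) :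
    ∀ s : Multiset ℂ, s.card = m + 2 → (∀ x ∈ s, x ∈ K) →
      Γ.integral (fun z => ((s.map (fun x => z - x)).prod)⁻¹) = 0 := by
  have hone : ∀ x ∈ K, Γ.integral (fun z => (z - x)⁻¹) = 2 * Real.pi * Complex.I := by
    intro x hx
    have := hw x hx
    rw [Contour.windingNumber, inv_mul_eq_one₀ two_pi_I_ne_zero] at this
    exact this.symm
  have hcont := fun s hs => continuousOn_inv_multiset_prod (K := K) hΓ s hs
  induction m using Nat.strong_induction_on with
  | _ m ih =>
  intro s hcard hs
  obtain ⟨x, hx⟩ : ∃ x, x ∈ s := Multiset.card_pos_iff_exists_mem.1 (by omega)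
  obtain ⟨u, rfl⟩ := Multiset.exists_cons_of_mem hx
  -- Two distinct nodes are separated by partial fractions, which removes one factor; if all nodes
  -- agree, the integrand is a power of order at least 2 and has a primitive.
  by_cases hy : ∃ y ∈ u, y ≠ x
  · obtain ⟨y, hyu, hyx⟩ := hy
    obtain ⟨t, rfl⟩ := Multiset.exists_cons_of_mem hyu
    simp only [Multiset.card_cons, add_left_inj] at hcard
    have hxt : ∀ w ∈ x ::ₘ t, w ∈ K := fun w hw => hs w (by
      simp only [Multiset.mem_cons] at hw ⊢; tauto)
    have hyt : ∀ w ∈ y ::ₘ t, w ∈ K := fun w hw => hs w (by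
      simp only [Multiset.mem_cons] at hw ⊢; tauto)
    have hxy : x - y ≠ 0 := sub_ne_zero.2 hyx.symm
    have key : Γ.integral (fun z => (((x ::ₘ y ::ₘ t).map (fun x => z - x)).prod)⁻¹) =
        (x - y)⁻¹ * (Γ.integral (fun z => (((x ::ₘ t).map (fun x => z - x)).prod)⁻¹) -
          Γ.integral (fun z => (((y ::ₘ t).map (fun x => z - x)).prod)⁻¹)) := by
      rw [← Contour.integral_sub _ (hcont _ hxt) (hcont _ hyt), ← Contour.integral_const_mul]
      refine Contour.integral_congr _ fun z hz => ?_
      have hzx : z - x ≠ 0 := sub_ne_zero.2 (hΓ.ne_of_mem hz (hs x (by simp)))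
      have hzy : z - y ≠ 0 := sub_ne_zero.2 (hΓ.ne_of_mem hz (hs y (by simp)))
      simp only [Multiset.map_cons, Multiset.prod_cons, mul_inv]
      generalize ((t.map (fun x => z - x)).prod)⁻¹ = p
      field_simp
      ring
    rw [key]
    rcases m with _ | m
    -- With two simple factors left, both integrals equal 2πi and cancel.
    · obtain rfl : t = 0 := Multiset.card_eq_zero.1 (by omega)
      simp [hone x (hs x (by simp)), hone y (hs y (by simp))]
    · rw [ih m (by omega) _ (by simp; omega) hxt, ih m (by omega) _ (by simp; omega) hyt]
      simp
  · push Not at hy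
    obtain rfl : u = Multiset.replicate (m + 1) x := by
      rw [Multiset.eq_replicate]
      exact ⟨by simpa using hcard, hy⟩
    have hzx : ∀ z ∈ Γ.trace, z - x ≠ 0 := fun z hz =>
      sub_ne_zero.2 (hΓ.ne_of_mem hz (hs x (by simp)))
    refine Γ.integral_eq_zero_of_primitive (F := fun z => -((m + 1 : ℂ))⁻¹ * ((z - x) ^ (m + 1))⁻¹)
      (fun z hz => ?_) (hcont _ hs)
    have h0 := hzx z hz
    have h1 := ((((hasDerivAt_id z).sub_const x).pow (m + 1)).inv
      (pow_ne_zero _ h0)).const_mul (-((m + 1 : ℂ))⁻¹)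
    refine h1.congr_deriv ?_
    have hm : (m + 1 : ℂ) ≠ 0 := Nat.cast_add_one_ne_zero m
    simp
    field_simp
    ring

end Winding

/-! ### Functional calculus by resolvent integrals and its independence of the contour. -/

section Resolvent

variable {n : ℕ}

/-- The matrix with entries `(2πi)⁻¹ ∫_Γ h(z) ((zI - A)⁻¹)_{kl} dz`. -/
noncomputable def resolventIntegral (Γ : Contour) (A : Matrix (Fin n) (Fin n) ℂ) (h : ℂ → ℂ) :
    Matrix (Fin n) (Fin n) ℂ :=
  Matrix.of fun k l => (2 * Real.pi * Complex.I)⁻¹ *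
    Γ.integral (fun z => h z * ((z • (1 : Matrix (Fin n) (Fin n) ℂ) - A)⁻¹) k l)

variable {A : Matrix (Fin n) (Fin n) ℂ}

theorem isUnit_det_of_notMem_spectrum {z : ℂ} (hz : z ∉ spectrum ℂ A) :
    IsUnit (z • (1 : Matrix (Fin n) (Fin n) ℂ) - A).det := by
  rw [spectrum.notMem_iff, Algebra.algebraMap_eq_smul_one] at hz
  exact (Matrix.isUnit_iff_isUnit_det _).1 hz

theorem continuousOn_resolvent {S : Set ℂ} (hS : Disjoint S (spectrum ℂ A)) (k l : Fin n) :
    ContinuousOn (fun z : ℂ => ((z • (1 : Matrix (Fin n) (Fin n) ℂ) - A)⁻¹) k l) S := by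
  have h1 : Continuous (fun z : ℂ => z • (1 : Matrix (Fin n) (Fin n) ℂ) - A) := by fun_prop
  simp only [Matrix.inv_def, Ring.inverse_eq_inv', Matrix.smul_apply, smul_eq_mul]
  refine ContinuousOn.mul (ContinuousOn.inv₀ h1.matrix_det.continuousOn fun z hz => ?_)
    (h1.matrix_adjugate.matrix_elem k l).continuousOn
  exact (isUnit_det_of_notMem_spectrum (hS.notMem_of_mem_left hz)).ne_zero

variable {Γ : Contour}

theorem resolventIntegral_congr {g h : ℂ → ℂ} (hgh : ∀ z ∈ Γ.trace, g z = h z) :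
    resolventIntegral Γ A g = resolventIntegral Γ A h := by
  ext k l
  simp only [resolventIntegral, Matrix.of_apply]
  rw [Γ.integral_congr fun z hz => by rw [hgh z hz]]

theorem resolventIntegral_add (hΓ : Disjoint Γ.trace (spectrum ℂ A)) {g h : ℂ → ℂ}
    (hg : ContinuousOn g Γ.trace) (hh : ContinuousOn h Γ.trace) :
    resolventIntegral Γ A (fun z => g z + h z) =
      resolventIntegral Γ A g + resolventIntegral Γ A h := by
  ext k l
  have hR := continuousOn_resolvent hΓ k l
  simp only [resolventIntegral, Matrix.of_apply, Matrix.add_apply, add_mul]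
  have h1 := Γ.integral_add (g := fun z => g z * ((z • (1 : Matrix (Fin n) (Fin n) ℂ) - A)⁻¹) k l)
    (h := fun z => h z * ((z • (1 : Matrix (Fin n) (Fin n) ℂ) - A)⁻¹) k l)
    (hg.mul hR) (hh.mul hR)
  rw [h1, mul_add]

theorem resolventIntegral_const_mul (a : ℂ) (g : ℂ → ℂ) :
    resolventIntegral Γ A (fun z => a * g z) = a • resolventIntegral Γ A g := by
  ext k l
  simp only [resolventIntegral, Matrix.of_apply, Matrix.smul_apply, smul_eq_mul, mul_assoc]
  rw [Γ.integral_const_mul, mul_left_comm]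

/-- Integrated form of the identity (z-x)(zI-A)⁻¹ = I + (A-x)(zI-A)⁻¹. The scalar term disappears
when h is holomorphic on the slit plane, or is evaluated by winding numbers when h is a reciprocal
product. -/
theorem resolventIntegral_sub_mul (hΓ : Disjoint Γ.trace (spectrum ℂ A)) {h : ℂ → ℂ}
    (hh : ContinuousOn h Γ.trace) (x : ℂ) :
    resolventIntegral Γ A (fun z => (z - x) * h z) =
      ((2 * Real.pi * Complex.I)⁻¹ * Γ.integral h) • (1 : Matrix (Fin n) (Fin n) ℂ) +
        (A - x • (1 : Matrix (Fin n) (Fin n) ℂ)) * resolventIntegral Γ A h := by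
  ext k l
  have hR := fun j => continuousOn_resolvent hΓ j l
  simp only [resolventIntegral, Matrix.of_apply, Matrix.add_apply, Matrix.smul_apply, smul_eq_mul,
    Matrix.mul_apply]
  have h1 := Γ.integral_finset_sum Finset.univ (g := fun j z =>
    (A - x • (1 : Matrix (Fin n) (Fin n) ℂ)) k j *
      (h z * ((z • (1 : Matrix (Fin n) (Fin n) ℂ) - A)⁻¹) j l))
    fun j _ => continuousOn_const.mul (hh.mul (hR j))
  have h2 := Γ.integral_add (g := fun z => (1 : Matrix (Fin n) (Fin n) ℂ) k l * h z)
    (h := fun z => ∑ j, (A - x • (1 : Matrix (Fin n) (Fin n) ℂ)) k j *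
      (h z * ((z • (1 : Matrix (Fin n) (Fin n) ℂ) - A)⁻¹) j l))
    (continuousOn_const.mul hh)
    (continuousOn_finsetSum _ fun j _ => continuousOn_const.mul (hh.mul (hR j)))
  simp only [Contour.integral_const_mul] at h1 h2
  have h3 : ∀ j, (A - x • (1 : Matrix (Fin n) (Fin n) ℂ)) k j * ((2 * Real.pi * Complex.I)⁻¹ *
      Γ.integral fun z => h z * ((z • (1 : Matrix (Fin n) (Fin n) ℂ) - A)⁻¹) j l) =
      (2 * Real.pi * Complex.I)⁻¹ * ((A - x • (1 : Matrix (Fin n) (Fin n) ℂ)) k j *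
        Γ.integral fun z => h z * ((z • (1 : Matrix (Fin n) (Fin n) ℂ) - A)⁻¹) j l) :=
    fun j => mul_left_comm _ _ _
  rw [Finset.sum_congr rfl fun j _ => h3 j, ← Finset.mul_sum, ← h1,
    mul_assoc _ (Γ.integral h), ← mul_add,
    mul_comm (Γ.integral h), ← h2]
  congr 1
  refine Γ.integral_congr fun z hz => ?_
  have hu := isUnit_det_of_notMem_spectrum (hΓ.notMem_of_mem_left hz)
  have key : (z - x) • (z • (1 : Matrix (Fin n) (Fin n) ℂ) - A)⁻¹ =
      1 + (A - x • (1 : Matrix (Fin n) (Fin n) ℂ)) * (z • (1 : Matrix (Fin n) (Fin n) ℂ) - A)⁻¹ := by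
    have h1 := Matrix.mul_nonsing_inv _ hu
    rw [Matrix.sub_mul, Matrix.smul_mul, Matrix.one_mul] at h1 ⊢
    rw [sub_eq_iff_eq_add] at h1
    rw [sub_smul, h1]
    abel
  have key' := congrFun (congrFun key k) l
  simp only [Matrix.smul_apply, smul_eq_mul, Matrix.add_apply, Matrix.mul_apply] at key'
  calc (z - x) * h z * ((z • (1 : Matrix (Fin n) (Fin n) ℂ) - A)⁻¹) k l
      = h z * ((z - x) * ((z • (1 : Matrix (Fin n) (Fin n) ℂ) - A)⁻¹) k l) := by ring
    _ = _ := by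
      rw [key', mul_add, Finset.mul_sum, mul_comm]
      congr 1
      exact Finset.sum_congr rfl fun j _ => by ring

theorem prod_charpoly_roots_eq_zero (A : Matrix (Fin n) (Fin n) ℂ) :
    (A.charpoly.roots.toList.map
      (fun x => A - x • (1 : Matrix (Fin n) (Fin n) ℂ))).prod = 0 := by
  have h1 := Matrix.aeval_self_charpoly A
  rw [(IsAlgClosed.splits A.charpoly).eq_prod_roots_of_monic (Matrix.charpoly_monic A),
    ← Multiset.coe_toList A.charpoly.roots] at h1
  simp only [Multiset.map_coe, Multiset.prod_coe, map_list_prod, List.map_map] at h1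
  rw [← h1]
  congr 1
  refine List.map_congr_left fun x _ => ?_
  simp [Algebra.algebraMap_eq_smul_one]

theorem mem_spectrum_of_mem_roots {x : ℂ} (hx : x ∈ A.charpoly.roots.toList) :
    x ∈ spectrum ℂ A := by
  rw [Multiset.mem_toList, Polynomial.mem_roots (Matrix.charpoly_monic A).ne_zero] at hx
  exact Matrix.mem_spectrum_iff_isRoot_charpoly.2 hx

/-- Write 1 = (z-x)·(z-x)⁻¹ and apply `resolventIntegral_sub_mul` once per root of the
characteristic polynomial. The first step contributes a winding number, hence I; later scalar terms
are integrals of products of at least two reciprocals and vanish; Cayley–Hamilton kills the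
remainder. Only winding numbers at eigenvalues enter. -/
theorem resolventIntegral_one (hΓ : Disjoint Γ.trace (spectrum ℂ A))
    (hw : ∀ x ∈ spectrum ℂ A, Γ.windingNumber x = 1) :
    resolventIntegral Γ A (fun _ => 1) = 1 := by
  have step : ∀ (s : Multiset ℂ) (x : ℂ), x ∈ spectrum ℂ A → (∀ y ∈ s, y ∈ spectrum ℂ A) →
      resolventIntegral Γ A (fun z => ((s.map (fun x => z - x)).prod)⁻¹) =
        ((2 * Real.pi * Complex.I)⁻¹ *
          Γ.integral (fun z => (((x ::ₘ s).map (fun x => z - x)).prod)⁻¹)) •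
            (1 : Matrix (Fin n) (Fin n) ℂ) + (A - x • (1 : Matrix (Fin n) (Fin n) ℂ)) *
        resolventIntegral Γ A (fun z => (((x ::ₘ s).map (fun x => z - x)).prod)⁻¹) := by
    intro s x hx hs
    rw [← resolventIntegral_sub_mul hΓ (continuousOn_inv_multiset_prod hΓ _
      (by simpa using ⟨hx, hs⟩))]
    refine resolventIntegral_congr fun z hz => ?_
    have h0 : z - x ≠ 0 := sub_ne_zero.2 (hΓ.ne_of_mem hz hx)
    simp only [Multiset.map_cons, Multiset.prod_cons]
    rw [mul_inv, mul_inv_cancel_left₀ h0]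
  have hlist : ∀ (L : List ℂ) (s : Multiset ℂ), (∀ x ∈ L, x ∈ spectrum ℂ A) →
      (∀ y ∈ s, y ∈ spectrum ℂ A) → s ≠ 0 →
      resolventIntegral Γ A (fun z => ((s.map (fun x => z - x)).prod)⁻¹) =
        (L.map (fun x => A - x • (1 : Matrix (Fin n) (Fin n) ℂ))).prod *
          resolventIntegral Γ A (fun z => ((((L : Multiset ℂ) + s).map (fun x => z - x)).prod)⁻¹) := by
    intro L
    induction L with
    | nil => intro s _ _ _; simp
    | cons x L ih =>
      intro s hL hs hs0
      have hx : x ∈ spectrum ℂ A := hL x (by simp)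
      have hxs : ∀ y ∈ x ::ₘ s, y ∈ spectrum ℂ A := by simpa using ⟨hx, hs⟩
      obtain ⟨m, hm⟩ : ∃ m, (x ::ₘ s).card = m + 2 := by
        have := Multiset.card_pos.2 hs0
        exact ⟨s.card - 1, by simp; omega⟩
      rw [step s x hx hs, integral_inv_multiset_prod_eq_zero hΓ hw m _ hm hxs,
        ih (x ::ₘ s) (fun y hy => hL y (by simp [hy])) hxs (by simp)]
      simp only [mul_zero, zero_smul, zero_add, List.map_cons, List.prod_cons, Matrix.mul_assoc]
      congr 4
      rw [← Multiset.cons_coe, Multiset.cons_add, Multiset.add_cons]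
  have hzero := prod_charpoly_roots_eq_zero A
  have hmem := fun x (hx : x ∈ A.charpoly.roots.toList) => mem_spectrum_of_mem_roots hx
  generalize A.charpoly.roots.toList = L at hzero hmem
  cases L with
  | nil =>
    -- Without roots the empty product gives 1 = 0, so the matrix ring is trivial.
    simp only [List.map_nil, List.prod_nil] at hzero
    rw [← Matrix.one_mul (resolventIntegral Γ A _), hzero, Matrix.zero_mul]
  | cons x L =>
    have hx : x ∈ spectrum ℂ A := hmem x (by simp)
    have h1 := step 0 x hx (by simp)
    have h2 : (2 * Real.pi * Complex.I)⁻¹ * Γ.integral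
        (fun z => (((x ::ₘ (0 : Multiset ℂ)).map (fun x => z - x)).prod)⁻¹) = 1 := by
      simpa [Contour.windingNumber] using hw x hx
    rw [h2, hlist L (x ::ₘ 0) (fun y hy => hmem y (by simp [hy])) (by simpa using hx) (by simp),
      ← Matrix.mul_assoc] at h1
    rw [List.map_cons, List.prod_cons] at hzero
    rw [hzero] at h1
    simpa using h1

variable (Γ) in
/-- The contour represents the holomorphic functional calculus of `A` on the slit plane. -/
theorem resolventIntegral_mul {h : ℂ → ℂ} (hΓ : Γ.Encircles Complex.slitPlane (spectrum ℂ A))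
    (hh : DifferentiableOn ℂ h Complex.slitPlane) (x : ℂ) :
    resolventIntegral Γ A (fun z => (z - x) * h z) =
      (A - x • (1 : Matrix (Fin n) (Fin n) ℂ)) * resolventIntegral Γ A h := by
  have hsub : Γ.trace ⊆ Complex.slitPlane := hΓ.1.trans sdiff_subset
  have hdis : Disjoint Γ.trace (spectrum ℂ A) := (subset_sdiff.1 hΓ.1).2
  rw [resolventIntegral_sub_mul hdis (hh.continuousOn.mono hsub),
    Γ.integral_eq_zero_of_differentiableOn hsub hh]
  simp

/-- Newton interpolation at the eigenvalues: the contour integral does not depend on the contour. -/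
theorem exists_eq_resolventIntegral (hA : spectrum ℂ A ⊆ Complex.slitPlane) {h : ℂ → ℂ}
    (hh : DifferentiableOn ℂ h Complex.slitPlane) :
    ∃ B, ∀ Γ : Contour, Γ.Encircles Complex.slitPlane (spectrum ℂ A) →
      resolventIntegral Γ A h = B := by
  have hlist : ∀ (L : List ℂ), (∀ x ∈ L, x ∈ spectrum ℂ A) → ∀ h : ℂ → ℂ,
      DifferentiableOn ℂ h Complex.slitPlane → ∃ (B : Matrix (Fin n) (Fin n) ℂ) (h' : ℂ → ℂ),
      ∀ Γ : Contour, Γ.Encircles Complex.slitPlane (spectrum ℂ A) → resolventIntegral Γ A h =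
        B + (L.map (fun x => A - x • (1 : Matrix (Fin n) (Fin n) ℂ))).prod *
          resolventIntegral Γ A h' := by
    intro L
    induction L with
    | nil => intro _ h _; exact ⟨0, h, fun Γ _ => by simp⟩
    | cons x L ih =>
      intro hL h hh
      have hx : x ∈ spectrum ℂ A := hL x (by simp)
      have hd : DifferentiableOn ℂ (dslope h x) Complex.slitPlane :=
        (Complex.differentiableOn_dslope (Complex.isOpen_slitPlane.mem_nhds (hA hx))).2 hh
      obtain ⟨B, h', hB⟩ := ih (fun y hy => hL y (by simp [hy])) _ hd
      refine ⟨h x • (1 : Matrix (Fin n) (Fin n) ℂ) +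
        (A - x • (1 : Matrix (Fin n) (Fin n) ℂ)) * B, h', fun Γ hΓ => ?_⟩
      have hsub : Γ.trace ⊆ Complex.slitPlane := hΓ.1.trans sdiff_subset
      have hdis : Disjoint Γ.trace (spectrum ℂ A) := (subset_sdiff.1 hΓ.1).2
      -- One Newton step, h(z) = h(x) + (z-x)h[x,z]. The divided difference is again holomorphic,
      -- and neither B nor h' depends on Γ.
      have h1 : resolventIntegral Γ A h = resolventIntegral Γ A
          (fun z => h x * 1 + (z - x) * dslope h x z) :=
        resolventIntegral_congr fun z _ => by
          have := sub_smul_dslope h x z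
          rw [smul_eq_mul] at this
          rw [this]; ring
      rw [h1, resolventIntegral_add (h := fun z => (z - x) * dslope h x z) hdis continuousOn_const
        (((continuous_id.sub continuous_const).continuousOn).mul (hd.continuousOn.mono hsub)),
        resolventIntegral_const_mul, resolventIntegral_one hdis hΓ.2.1,
        resolventIntegral_mul Γ hΓ hd, hB Γ hΓ, Matrix.mul_add, List.map_cons, List.prod_cons,
        Matrix.mul_assoc, add_assoc]
  obtain ⟨B, h', hB⟩ := hlist _ (fun x hx => mem_spectrum_of_mem_roots hx) h hh
  refine ⟨B, fun Γ hΓ => ?_⟩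
  rw [hB Γ hΓ, prod_charpoly_roots_eq_zero, Matrix.zero_mul, add_zero]

end Resolvent

end MatrixDecay

namespace MatrixDecay

open Set MeasureTheory

/-! ### The Joukowski map and confocal ellipses. -/

section Joukowski

/-- The image of the closed disc of radius `r` under `w ↦ w + κ / w`, that is, the closed region
bounded by the ellipse with semi-axes `r + κ / r` and `r - κ / r`. -/
def joukowskiRegion (κ r : ℝ) : Set ℂ :=
  {ζ | (ζ.re / (r + κ / r)) ^ 2 + (ζ.im / (r - κ / r)) ^ 2 ≤ 1}

variable {κ r : ℝ} {ζ u₁ u₂ : ℂ}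

theorem joukowskiRegion_mono {ζ' : ℂ} (hζ : ζ ∈ joukowskiRegion κ r) (hre : |ζ'.re| ≤ |ζ.re|)
    (him : |ζ'.im| ≤ |ζ.im|) : ζ' ∈ joukowskiRegion κ r := by
  refine le_trans ?_ (show _ ≤ (1 : ℝ) from hζ)
  simp only [div_pow]
  gcongr ?_ / _ + ?_ / _
  · exact sq_le_sq.2 hre
  · exact sq_le_sq.2 him

/-- Polar form: for u₁ = s·exp(iθ), ζ = (s + κ/s) cos θ + i (s - κ/s) sin θ. A preimage pair is
encoded by its sum and product so that κ = 0 needs no separate treatment. -/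
theorem re_add_im_of_mul_eq (h0 : u₁ ≠ 0) (hadd : u₁ + u₂ = ζ) (hmul : u₁ * u₂ = κ) :
    ζ.re = u₁.re / ‖u₁‖ * (‖u₁‖ + κ / ‖u₁‖) ∧ ζ.im = u₁.im / ‖u₁‖ * (‖u₁‖ - κ / ‖u₁‖) := by
  have hn : ‖u₁‖ ≠ 0 := norm_ne_zero_iff.2 h0
  have hsq : ‖u₁‖ ^ 2 = u₁.re * u₁.re + u₁.im * u₁.im := by
    rw [← Complex.normSq_eq_norm_sq, Complex.normSq_apply]
  have hre := congrArg Complex.re hmul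
  have him := congrArg Complex.im hmul
  simp only [Complex.mul_re, Complex.mul_im, Complex.ofReal_re, Complex.ofReal_im] at hre him
  rw [← hadd, Complex.add_re, Complex.add_im]
  have e1 : ‖u₁‖ ^ 2 * u₂.re = κ * u₁.re := by rw [hsq]; linear_combination u₁.re * hre + u₁.im * him
  have e2 : ‖u₁‖ ^ 2 * u₂.im = -κ * u₁.im := by
    rw [hsq]; linear_combination u₁.re * him - u₁.im * hre
  constructor
  · field_simp
    linear_combination e1
  · field_simp
    linear_combination e2

/-- The point ζ lies on the confocal ellipse of parameter s = |u₁|. If s > r, both of its semi-axes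
exceed those for r, since rs > κ, and ζ lies outside the region. -/
theorem norm_le_of_mem_joukowskiRegion (hκ : 0 ≤ κ) (hκ1 : κ < 1) (hr : 1 ≤ r)
    (hadd : u₁ + u₂ = ζ) (hmul : u₁ * u₂ = κ) (hζ : ζ ∈ joukowskiRegion κ r) : ‖u₁‖ ≤ r := by
  by_contra! hs
  have hr0 : 0 < r := by linarith
  have h0 : u₁ ≠ 0 := norm_pos_iff.1 (hr0.trans hs)
  obtain ⟨hre, him⟩ := re_add_im_of_mul_eq h0 hadd hmul
  have hsq : ‖u₁‖ ^ 2 = u₁.re * u₁.re + u₁.im * u₁.im := by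
    rw [← Complex.normSq_eq_norm_sq, Complex.normSq_apply]
  set s := ‖u₁‖
  have hs0 : 0 < s := hr0.trans hs
  have hrs : κ < r * s := by nlinarith
  have hκr : κ / r < r := by rw [div_lt_iff₀ hr0]; nlinarith
  have hB : 0 < r - κ / r := sub_pos.2 hκr
  have hA : 0 < r + κ / r := by positivity
  have hAs : r + κ / r < s + κ / s := by
    have : s + κ / s - (r + κ / r) = (s - r) * (r * s - κ) / (r * s) := by field_simp; ring
    have h2 : 0 < (s - r) * (r * s - κ) / (r * s) :=
      div_pos (mul_pos (sub_pos.2 hs) (sub_pos.2 hrs)) (mul_pos hr0 hs0)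
    linarith
  have hBs : r - κ / r < s - κ / s := by
    have : κ / s ≤ κ / r := div_le_div_of_nonneg_left hκ hr0 hs.le
    linarith
  have hP : 1 < ((s + κ / s) / (r + κ / r)) ^ 2 := one_lt_pow₀ ((one_lt_div hA).2 hAs) two_ne_zero
  have hQ : 1 < ((s - κ / s) / (r - κ / r)) ^ 2 := one_lt_pow₀ ((one_lt_div hB).2 hBs) two_ne_zero
  have hXY : (u₁.re / s) ^ 2 + (u₁.im / s) ^ 2 = 1 := by
    field_simp; linarith
  have h1 : (ζ.re / (r + κ / r)) ^ 2 + (ζ.im / (r - κ / r)) ^ 2 ≤ 1 := hζ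
  rw [hre, him, mul_div_assoc, mul_div_assoc, mul_pow, mul_pow] at h1
  have hX := sq_nonneg (u₁.re / s)
  have hY := mul_nonneg (sq_nonneg (u₁.im / s)) (sub_pos.2 hQ).le
  rcases hX.eq_or_lt with hX | hX
  · rw [← hX] at h1 hXY
    rw [zero_add] at hXY
    rw [hXY] at h1
    linarith
  · have := mul_pos hX (sub_pos.2 hP)
    linarith

/-- Converse of the preceding lemma: for u₁ ≠ 0 the two norm bounds say κ/r ≤ s ≤ r with s = |u₁|,
and in this range neither s + κ/s nor |s - κ/s| exceeds its value at r. -/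
theorem mem_joukowskiRegion (hκ : 0 ≤ κ) (hκ1 : κ < 1) (hr : 1 ≤ r) (hadd : u₁ + u₂ = ζ)
    (hmul : u₁ * u₂ = κ) (h₁ : ‖u₁‖ ≤ r) (h₂ : ‖u₂‖ ≤ r) : ζ ∈ joukowskiRegion κ r := by
  have hr0 : 0 < r := by linarith
  have hκr : κ / r < r := by rw [div_lt_iff₀ hr0]; nlinarith
  have hB : 0 < r - κ / r := sub_pos.2 hκr
  have hA : 0 < r + κ / r := by positivity
  have hnorm : ‖u₁‖ * ‖u₂‖ = κ := by
    rw [← norm_mul, hmul, Complex.norm_real, Real.norm_of_nonneg hκ]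
  show (ζ.re / (r + κ / r)) ^ 2 + (ζ.im / (r - κ / r)) ^ 2 ≤ 1
  rcases eq_or_ne u₁ 0 with rfl | h0
  · have : κ = 0 := by simpa using hnorm.symm
    subst this
    rw [zero_add] at hadd
    subst hadd
    have hsq : ‖u₂‖ ^ 2 = u₂.re * u₂.re + u₂.im * u₂.im := by
      rw [← Complex.normSq_eq_norm_sq, Complex.normSq_apply]
    have h3 : ‖u₂‖ ^ 2 ≤ r ^ 2 := by gcongr
    simp only [zero_div, add_zero, sub_zero, div_pow]
    rw [← add_div, div_le_one (by positivity)]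
    linarith
  obtain ⟨hre, him⟩ := re_add_im_of_mul_eq h0 hadd hmul
  have hsq : ‖u₁‖ ^ 2 = u₁.re * u₁.re + u₁.im * u₁.im := by
    rw [← Complex.normSq_eq_norm_sq, Complex.normSq_apply]
  have hs0 : 0 < ‖u₁‖ := norm_pos_iff.2 h0
  have hu₂ : ‖u₂‖ = κ / ‖u₁‖ := by field_simp; linarith
  rw [hu₂] at h₂
  set s := ‖u₁‖
  have hrs : κ ≤ r * s := by rwa [div_le_iff₀ hs0] at h₂
  have hAs : s + κ / s ≤ r + κ / r := by
    have : r + κ / r - (s + κ / s) = (r - s) * (r * s - κ) / (r * s) := by field_simp; ring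
    have h2 : 0 ≤ (r - s) * (r * s - κ) / (r * s) :=
      div_nonneg (mul_nonneg (sub_nonneg.2 h₁) (sub_nonneg.2 hrs)) (mul_pos hr0 hs0).le
    linarith
  have hBs : |s - κ / s| ≤ r - κ / r := by
    have h3 : κ / r ≤ κ / s := div_le_div_of_nonneg_left hκ hs0 h₁
    have h4 : κ / r ≤ s := by rw [div_le_iff₀ hr0]; linarith
    exact abs_le.2 ⟨by linarith, by linarith⟩
  have hP : ((s + κ / s) / (r + κ / r)) ^ 2 ≤ 1 :=
    pow_le_one₀ (by positivity) ((div_le_one hA).2 hAs)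
  have hQ : ((s - κ / s) / (r - κ / r)) ^ 2 ≤ 1 := by
    rw [← sq_abs, abs_div, abs_of_pos hB]
    exact pow_le_one₀ (by positivity) ((div_le_one hB).2 hBs)
  have hXY : (u₁.re / s) ^ 2 + (u₁.im / s) ^ 2 = 1 := by
    field_simp; linarith
  rw [hre, him, mul_div_assoc, mul_div_assoc, mul_pow, mul_pow]
  nlinarith [sq_nonneg (u₁.re / s), sq_nonneg (u₁.im / s)]

/-- Otherwise both moduli are at most 1, and (1-|u₁|)(1-|u₂|) ≥ 0 together with |u₁||u₂| = κ gives
|ζ| ≤ 1 + κ. -/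
theorem one_lt_norm_of_lt_norm_add (hκ : 0 ≤ κ) (hadd : u₁ + u₂ = ζ) (hmul : u₁ * u₂ = κ)
    (hle : ‖u₂‖ ≤ ‖u₁‖) (hζ : 1 + κ < ‖ζ‖) : 1 < ‖u₁‖ := by
  by_contra! h
  have hnorm : ‖u₁‖ * ‖u₂‖ = κ := by
    rw [← norm_mul, hmul, Complex.norm_real, Real.norm_of_nonneg hκ]
  have h2 := norm_add_le u₁ u₂
  rw [hadd] at h2
  nlinarith

theorem exists_add_eq_mul_eq (ζ κ : ℂ) : ∃ u₁ u₂ : ℂ, u₁ + u₂ = ζ ∧ u₁ * u₂ = κ ∧ ‖u₂‖ ≤ ‖u₁‖ := by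
  have h := sqrt_sq (ζ ^ 2 - 4 * κ)
  set S := Complex.sqrt (ζ ^ 2 - 4 * κ)
  rcases le_total ‖(ζ - S) / 2‖ ‖(ζ + S) / 2‖ with h1 | h1
  · exact ⟨_, _, by ring, by linear_combination -h / 4, h1⟩
  · exact ⟨_, _, by ring, by linear_combination -h / 4, h1⟩

end Joukowski

/-! ### The principal root selects the exterior preimage. -/

section LevelRadius

/-- As ρ is real, S = √(z²-ρ) satisfies Re S · Im S = Re z · Im z. With Re z > 0 and Re S ≥ 0 this
makes the real inner product of z and S nonnegative. -/
theorem norm_sub_sqrt_le (ρ : ℝ) {z : ℂ} (hz : 0 < z.re) :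
    ‖z - Complex.sqrt (z ^ 2 - ρ)‖ ≤ ‖z + Complex.sqrt (z ^ 2 - ρ)‖ := by
  have h := sqrt_sq (z ^ 2 - ρ)
  have hS := sqrt_re_nonneg (z ^ 2 - ρ)
  set S := Complex.sqrt (z ^ 2 - ρ)
  have him := congrArg Complex.im h
  simp only [sq, Complex.mul_im, Complex.sub_im, Complex.ofReal_im] at him
  have key : 0 ≤ z.im * S.im := by
    rcases hS.eq_or_lt with h0 | h0
    · rw [← h0] at him
      have : z.im = 0 := by
        have : z.re * z.im = 0 := by linarith
        exact (mul_eq_zero.1 this).resolve_left hz.ne'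
      simp [this]
    · have h1 : S.re * S.im = z.re * z.im := by linarith
      have h2 : S.re * (z.im * S.im) = z.re * z.im ^ 2 := by linear_combination z.im * h1
      have h3 : 0 ≤ S.re * (z.im * S.im) := h2 ▸ by positivity
      exact nonneg_of_mul_nonneg_right h3 h0
  rw [← sq_le_sq₀ (norm_nonneg _) (norm_nonneg _), ← Complex.normSq_eq_norm_sq,
    ← Complex.normSq_eq_norm_sq, Complex.normSq_apply, Complex.normSq_apply]
  simp only [Complex.sub_re, Complex.sub_im, Complex.add_re, Complex.add_im]
  nlinarith [mul_nonneg hz.le hS]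

theorem norm_mul_one_add_sqrt (ρ : ℝ) {z : ℂ} (hz : 0 < z.re) :
    ‖z‖ * ‖1 + Complex.sqrt (1 - ρ / z ^ 2)‖ = ‖z + Complex.sqrt (z ^ 2 - ρ)‖ := by
  have hz0 : z ≠ 0 := fun h => by simp [h] at hz
  have h := sqrt_sq (z ^ 2 - ρ)
  have hle := norm_sub_sqrt_le ρ hz
  have h' := sqrt_sq (1 - ρ / z ^ 2)
  have hS' := sqrt_re_nonneg (1 - ρ / z ^ 2)
  set S := Complex.sqrt (z ^ 2 - ρ)
  set s := Complex.sqrt (1 - ρ / z ^ 2)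
  have hsq : (z * s) ^ 2 = S ^ 2 := by rw [mul_pow, h', h]; field_simp
  rw [← norm_mul, mul_add, mul_one]
  -- The two roots may differ in sign. Then both sign choices obey the norm comparison, which forces
  -- equal norms.
  rcases sq_eq_sq_iff_eq_or_eq_neg.1 hsq with h1 | h1
  · rw [h1]
  · have h2 : ‖z - z * s‖ ≤ ‖z + z * s‖ := by
      have e1 : z - z * s = z * (1 - s) := by ring
      have e2 : z + z * s = z * (1 + s) := by ring
      rw [e1, e2, norm_mul, norm_mul]
      gcongr
      rw [← sq_le_sq₀ (norm_nonneg _) (norm_nonneg _), ← Complex.normSq_eq_norm_sq,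
        ← Complex.normSq_eq_norm_sq, Complex.normSq_apply, Complex.normSq_apply]
      simp
      nlinarith
    rw [h1] at h2 ⊢
    rw [sub_neg_eq_add, ← sub_eq_add_neg] at h2
    rw [← sub_eq_add_neg]
    exact le_antisymm hle h2

end LevelRadius

end MatrixDecay

namespace MatrixDecay

open Set MeasureTheory Real

/-! ### Carathéodory's inequality for matrix entries. -/

section Caratheodory

open ComplexConjugate

/-- On |u| = r one has u⁻¹ = conj(u)/r², so the integrand is the conjugate of a holomorphic function
vanishing at 0. -/
theorem circleAverage_inv_pow_mul_conj {r : ℝ} (hr : 0 < r) {h : ℂ → ℂ}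
    (hh : DiffContOnCl ℂ h (Metric.ball 0 r)) {j : ℕ} (hj : j ≠ 0) :
    circleAverage (fun u => (u⁻¹) ^ j * conj (h u)) 0 r = 0 := by
  have hd : DiffContOnCl ℂ (fun u : ℂ => (((r ^ 2 : ℝ) : ℂ)⁻¹) ^ j * (u ^ j * h u))
      (Metric.ball 0 |r|) := by
    rw [abs_of_pos hr]
    exact (diffContOnCl_const (c := (((r ^ 2 : ℝ) : ℂ)⁻¹) ^ j)).smul
      ((Differentiable.diffContOnCl (f := fun u : ℂ => u ^ j) (by fun_prop)).smul hh)
  have h1 := hd.circleAverage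
  simp only [ne_eq, hj, not_false_eq_true, zero_pow, zero_mul, mul_zero] at h1
  have hc : ContinuousOn (fun u : ℂ => (((r ^ 2 : ℝ) : ℂ)⁻¹) ^ j * (u ^ j * h u))
      (Metric.sphere 0 r) := by
    have hcont := hd.continuousOn
    rw [abs_of_pos hr, closure_ball _ hr.ne'] at hcont
    exact hcont.mono Metric.sphere_subset_closedBall
  have h2 := ContinuousLinearMap.circleAverage_comp_comm (Complex.conjCLE : ℂ →L[ℝ] ℂ)
    (hc.circleIntegrable hr.le)
  rw [h1, map_zero] at h2
  refine Eq.trans ?_ h2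
  apply circleAverage_congr_sphere
  intro u hu
  rw [abs_of_pos hr, mem_sphere_zero_iff_norm] at hu
  have hu0 : u ≠ 0 := norm_pos_iff.1 (hu ▸ hr)
  have e : u⁻¹ = conj u * (((r ^ 2 : ℝ) : ℂ)⁻¹) := by
    rw [← hu, Complex.inv_def, Complex.normSq_eq_norm_sq, Complex.ofReal_inv]
  simp [e, mul_pow]
  ring

theorem circleAverage_inv_pow {r : ℝ} (hr : 0 < r) {j : ℕ} (hj : j ≠ 0) :
    circleAverage (fun u : ℂ => (u⁻¹) ^ j) 0 r = 0 := by
  simpa using circleAverage_inv_pow_mul_conj hr (h := fun _ => 1) diffContOnCl_const hj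

variable {n : ℕ}

/-- The Hermitian part of G is positive semidefinite; it is tested on e_k - η e_l, with the
unimodular η rotating the off-diagonal entry onto the positive axis. -/
theorem norm_add_conj_le_of_re_nonneg {G : Matrix (Fin n) (Fin n) ℂ}
    (hG : ∀ x : Fin n → ℂ, 0 ≤ (star x ⬝ᵥ (G *ᵥ x)).re) (k l : Fin n) :
    ‖G k l + conj (G l k)‖ ≤ (G k k).re + (G l l).re := by
  have hquad : ∀ ζ : ℂ, star (Pi.single k 1 + ζ • Pi.single l 1 : Fin n → ℂ) ⬝ᵥ
      (G *ᵥ (Pi.single k 1 + ζ • Pi.single l 1)) =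
      G k k + conj ζ * ζ * G l l + ζ * G k l + conj ζ * G l k := by
    intro ζ
    have hs : ∀ i : Fin n, star (Pi.single i 1 : Fin n → ℂ) = Pi.single i 1 := fun i => by
      rw [← Pi.single_star, star_one]
    simp only [star_add, star_smul, hs, Matrix.mulVec_add, Matrix.mulVec_smul, dotProduct_add,
      add_dotProduct, smul_dotProduct, dotProduct_smul, Matrix.mulVec_single_one,
      single_one_dotProduct, Matrix.col_apply, smul_eq_mul, RCLike.star_def]
    ring
  obtain ⟨η, hη, hηv⟩ : ∃ η : ℂ, ‖η‖ = 1 ∧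
      η * (G k l + conj (G l k)) = ‖G k l + conj (G l k)‖ := by
    generalize G k l + conj (G l k) = v
    rcases eq_or_ne v 0 with rfl | hv
    · exact ⟨1, by simp, by simp⟩
    · have hv' : (‖v‖ : ℂ) ≠ 0 := by simpa using hv
      refine ⟨conj v / ‖v‖, by simp [hv], ?_⟩
      rw [div_mul_eq_mul_div, mul_comm, Complex.mul_conj, Complex.normSq_eq_norm_sq,
        Complex.ofReal_pow]
      field_simp
  have h1 := hG (Pi.single k 1 + (-η) • Pi.single l 1)
  rw [hquad] at h1
  have e1 : conj (-η) * (-η) = 1 := by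
    rw [mul_comm, Complex.mul_conj, Complex.normSq_eq_norm_sq, norm_neg, hη]; simp
  have e2 : (conj (-η) * G l k).re = ((-η) * conj (G l k)).re := by
    simp
  rw [e1, one_mul] at h1
  simp only [Complex.add_re] at h1
  have e3 : (-η * G k l).re + (-η * conj (G l k)).re = -‖G k l + conj (G l k)‖ := by
    rw [← Complex.add_re, ← mul_add (-η) (G k l) (conj (G l k)), neg_mul, hηv, Complex.neg_re,
      Complex.ofReal_re]
  rw [e2] at h1
  linarith

theorem norm_circleAverage_le {f : ℂ → ℂ} {g : ℂ → ℝ} {r : ℝ} (hg : CircleIntegrable g 0 r)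
    (hfg : ∀ u ∈ Metric.sphere (0 : ℂ) r, ‖f u‖ ≤ g u) (hr : 0 < r) :
    ‖circleAverage f 0 r‖ ≤ circleAverage g 0 r := by
  rw [circleAverage, circleAverage, norm_smul, smul_eq_mul, Real.norm_of_nonneg (by positivity)]
  gcongr
  refine intervalIntegral.norm_integral_le_of_norm_le Real.two_pi_pos.le ?_ hg
  exact Filter.Eventually.of_forall fun θ _ => hfg _ (circleMap_mem_sphere 0 hr.le θ)

/-- Carathéodory's coefficient inequality for the entries of a matrix function with positive
semidefinite real part. -/
theorem norm_circleAverage_inv_pow_mul_le {G : ℂ → Matrix (Fin n) (Fin n) ℂ} {r : ℝ} (hr : 0 < r)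
    (hd : ∀ k l, DiffContOnCl ℂ (fun u => G u k l) (Metric.ball 0 r)) (h0 : G 0 = 1)
    (hG : ∀ u ∈ Metric.sphere (0 : ℂ) r, ∀ x : Fin n → ℂ, 0 ≤ (star x ⬝ᵥ (G u *ᵥ x)).re)
    {j : ℕ} (hj : j ≠ 0) (k l : Fin n) :
    ‖circleAverage (fun u => (u⁻¹) ^ j * G u k l) 0 r‖ ≤ 2 * (r⁻¹) ^ j := by
  have hc : ∀ k l, ContinuousOn (fun u => G u k l) (Metric.sphere 0 r) := fun k l => by
    have := (hd k l).continuousOn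
    rw [closure_ball _ hr.ne'] at this
    exact this.mono Metric.sphere_subset_closedBall
  have hci : ContinuousOn (fun u : ℂ => (u⁻¹) ^ j) (Metric.sphere 0 r) := by
    refine (ContinuousOn.inv₀ continuousOn_id fun u hu => ?_).pow j
    rw [mem_sphere_zero_iff_norm] at hu
    exact norm_pos_iff.1 (hu ▸ hr)
  have hi1 : CircleIntegrable (fun u => (u⁻¹) ^ j * G u k l) 0 r :=
    (hci.mul (hc k l)).circleIntegrable hr.le
  have hi2 : CircleIntegrable (fun u => (u⁻¹) ^ j * conj (G u l k)) 0 r :=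
    (hci.mul (Complex.continuous_conj.comp_continuousOn (hc l k))).circleIntegrable hr.le
  have h1 := circleAverage_fun_add hi1 hi2
  -- Adding the conjugate transposed entry leaves the average unchanged and makes the integrand
  -- bounded by the real diagonal, whose averages are 1.
  rw [circleAverage_inv_pow_mul_conj hr (hd l k) hj, add_zero] at h1
  have hre : ∀ i, CircleIntegrable (fun u => (G u i i).re) 0 r := fun i =>
    (Complex.continuous_re.comp_continuousOn (hc i i)).circleIntegrable hr.le
  have havg : ∀ i, circleAverage (fun u => (G u i i).re) 0 r = 1 := fun i => by
    have h2 := Complex.reCLM.circleAverage_comp_comm ((hc i i).circleIntegrable hr.le)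
    have h3 := DiffContOnCl.circleAverage (c := 0) (R := r) (by rw [abs_of_pos hr]; exact hd i i)
    rw [h3, h0] at h2
    simpa [Function.comp_def] using h2
  rw [← h1]
  have hg : CircleIntegrable ((r⁻¹) ^ j • fun u => ((G u k k).re + (G u l l).re)) 0 r :=
    ((hre k).add (hre l)).const_smul
  refine (norm_circleAverage_le hg (fun u hu => ?_) hr).trans_eq ?_
  · rw [← mul_add, norm_mul, norm_pow, norm_inv, mem_sphere_zero_iff_norm.1 hu]
    simp only [Pi.smul_apply, smul_eq_mul]
    gcongr
    exact norm_add_conj_le_of_re_nonneg (hG u hu) k l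
  · rw [circleAverage_smul, circleAverage_fun_add (hre k) (hre l), havg, havg, smul_eq_mul]
    ring

end Caratheodory

/-! ### Positivity of the generating function. -/

section Dickson

open ComplexConjugate ComplexOrder

variable {n : ℕ} {κ : ℝ}

/-- Scalar core of the positivity. With m = p(1+κ) + iq(1-κ), p² + q² ≤ 1, the real part is affine
in (p,q), and Cauchy–Schwarz bounds its linear part by less than the constant term N. -/
theorem re_conj_mul_pos (hκ : 0 ≤ κ) (hκ1 : κ < 1) {m u : ℂ} (hm : m ∈ joukowskiRegion κ 1)
    (hu : ‖u‖ < 1) : 0 < (conj (1 - κ * u ^ 2) * (1 - m * u + κ * u ^ 2)).re := by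
  have hsq : ‖u‖ ^ 2 = u.re * u.re + u.im * u.im := by
    rw [← Complex.normSq_eq_norm_sq, Complex.normSq_apply]
  have hB : 0 < 1 - κ := by linarith
  have hm1 : (m.re / (1 + κ)) ^ 2 + (m.im / (1 - κ)) ^ 2 ≤ 1 := by
    simpa [joukowskiRegion] using hm
  set t := ‖u‖
  have ht0 : 0 ≤ t := norm_nonneg u
  set p := m.re / (1 + κ) with hp
  set q := m.im / (1 - κ) with hq
  have hp' : m.re = p * (1 + κ) := by rw [hp]; field_simp
  have hq' : m.im = q * (1 - κ) := by rw [hq]; field_simp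
  have hval : (conj (1 - κ * u ^ 2) * (1 - m * u + κ * u ^ 2)).re =
      (1 - κ * t ^ 2) * (1 + κ * t ^ 2) - (p * (u.re * ((1 + κ) * (1 - κ * t ^ 2))) -
        q * (u.im * ((1 - κ) * (1 + κ * t ^ 2)))) := by
    rw [hsq]
    simp [sq, hp', hq']
    ring
  rw [hval, sub_pos]
  set α := (1 + κ) * (1 - κ * t ^ 2)
  set β := (1 - κ) * (1 + κ * t ^ 2)
  set N := (1 - κ * t ^ 2) * (1 + κ * t ^ 2)
  have ht2 : κ * t ^ 2 < 1 := by nlinarith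
  have hN : 0 < N := mul_pos (by linarith) (by positivity)
  have hα0 : 0 ≤ α := mul_nonneg (by linarith) (by linarith)
  have hβ0 : 0 ≤ β := mul_nonneg hB.le (by positivity)
  have hα : t * α < N := by
    have : N - t * α = (1 - κ * t ^ 2) * ((1 - t) * (1 - κ * t)) := by ring
    have h2 : 0 < (1 - κ * t ^ 2) * ((1 - t) * (1 - κ * t)) :=
      mul_pos (by linarith) (mul_pos (by linarith) (by nlinarith))
    linarith
  have hβ : t * β < N := by
    have : N - t * β = (1 + κ * t ^ 2) * ((1 - t) * (1 + κ * t)) := by ring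
    have h2 : 0 < (1 + κ * t ^ 2) * ((1 - t) * (1 + κ * t)) :=
      mul_pos (by positivity) (mul_pos (by linarith) (by positivity))
    linarith
  -- Here μ = max(α, β), so that |(Re u · α, Im u · β)| ≤ tμ < N.
  obtain ⟨μ, hμ0, hαμ, hβμ, hμ⟩ : ∃ μ, 0 ≤ μ ∧ α ≤ μ ∧ β ≤ μ ∧ t * μ < N := by
    rcases le_total α β with h | h
    · exact ⟨β, hβ0, h, le_rfl, hβ⟩
    · exact ⟨α, hα0, le_rfl, h, hα⟩
  have hα2 : α ^ 2 ≤ μ ^ 2 := by gcongr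
  have hβ2 : β ^ 2 ≤ μ ^ 2 := by gcongr
  have hX : (u.re * α) ^ 2 + (u.im * β) ^ 2 ≤ (t * μ) ^ 2 := by
    have e : (t * μ) ^ 2 = u.re ^ 2 * μ ^ 2 + u.im ^ 2 * μ ^ 2 := by linear_combination μ ^ 2 * hsq
    rw [e, mul_pow u.re, mul_pow u.im]
    gcongr
  have hCS : (p * (u.re * α) - q * (u.im * β)) ^ 2 ≤
      (p ^ 2 + q ^ 2) * ((u.re * α) ^ 2 + (u.im * β) ^ 2) := by
    calc (p * (u.re * α) - q * (u.im * β)) ^ 2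
        ≤ (p * (u.re * α) - q * (u.im * β)) ^ 2 + (p * (u.im * β) + q * (u.re * α)) ^ 2 :=
          le_add_of_nonneg_right (sq_nonneg _)
      _ = _ := by ring
  have hle : (p * (u.re * α) - q * (u.im * β)) ^ 2 ≤ (t * μ) ^ 2 :=
    hCS.trans ((mul_le_of_le_one_left (by positivity) hm1).trans hX)
  exact (abs_le_of_sq_le_sq' hle (by positivity)).2.trans_lt hμ

variable {M : Matrix (Fin n) (Fin n) ℂ}

/-- The generating function `(1 - κu²)(1 - uM + κu²)⁻¹` of the Dickson polynomials at `M`. -/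
noncomputable def dicksonGenerating (κ : ℝ) (M : Matrix (Fin n) (Fin n) ℂ) (u : ℂ) :
    Matrix (Fin n) (Fin n) ℂ :=
  (1 - κ * u ^ 2) • ((1 + κ * u ^ 2) • (1 : Matrix (Fin n) (Fin n) ℂ) - u • M)⁻¹

theorem dotProduct_denominator (u : ℂ) {v : Fin n → ℂ} {m : ℂ}
    (hm : star v ⬝ᵥ (M *ᵥ v) = m * (star v ⬝ᵥ v)) :
    star v ⬝ᵥ (((1 + κ * u ^ 2) • (1 : Matrix (Fin n) (Fin n) ℂ) - u • M) *ᵥ v) =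
      (1 - m * u + κ * u ^ 2) * (star v ⬝ᵥ v) := by
  rw [Matrix.sub_mulVec, Matrix.smul_mulVec, Matrix.smul_mulVec, Matrix.one_mulVec,
    dotProduct_sub, dotProduct_smul, dotProduct_smul, hm]
  simp only [smul_eq_mul]
  ring

theorem isUnit_denominator (hκ : 0 ≤ κ) (hκ1 : κ < 1)
    (hM : ∀ v : Fin n → ℂ, ∃ m ∈ joukowskiRegion κ 1, star v ⬝ᵥ (M *ᵥ v) = m * (star v ⬝ᵥ v))
    {u : ℂ} (hu : ‖u‖ < 1) :
    IsUnit ((1 + κ * u ^ 2) • (1 : Matrix (Fin n) (Fin n) ℂ) - u • M).det := by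
  rw [isUnit_iff_ne_zero]
  intro hdet
  obtain ⟨v, hv, hv0⟩ := Matrix.exists_mulVec_eq_zero_iff.2 hdet
  obtain ⟨m, hm, hmv⟩ := hM v
  have h1 := dotProduct_denominator (κ := κ) u hmv
  rw [hv0, dotProduct_zero, eq_comm, mul_eq_zero,
    or_iff_left (dotProduct_star_self_eq_zero.not.2 hv)] at h1
  have := re_conj_mul_pos hκ hκ1 hm hu
  rw [h1] at this
  simp at this

/-- Substituting x = (1 - uM + κu²)y turns the quadratic form of the inverse into that of the
denominator at y, which is the scalar case at a point m of the ellipse times |y|². -/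
theorem dicksonGenerating_re_nonneg (hκ : 0 ≤ κ) (hκ1 : κ < 1)
    (hM : ∀ v : Fin n → ℂ, ∃ m ∈ joukowskiRegion κ 1, star v ⬝ᵥ (M *ᵥ v) = m * (star v ⬝ᵥ v))
    {u : ℂ} (hu : ‖u‖ < 1) (x : Fin n → ℂ) :
    0 ≤ (star x ⬝ᵥ (dicksonGenerating κ M u *ᵥ x)).re := by
  have hunit := isUnit_denominator hκ hκ1 hM hu
  set y := ((1 + κ * u ^ 2) • (1 : Matrix (Fin n) (Fin n) ℂ) - u • M)⁻¹ *ᵥ x with hy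
  have hx : x = ((1 + κ * u ^ 2) • (1 : Matrix (Fin n) (Fin n) ℂ) - u • M) *ᵥ y := by
    rw [hy, Matrix.mulVec_mulVec, Matrix.mul_nonsing_inv _ hunit, Matrix.one_mulVec]
  obtain ⟨m, hm, hmv⟩ := hM y
  have h1 := dotProduct_denominator (κ := κ) u hmv
  rw [← hx] at h1
  rw [dicksonGenerating, Matrix.smul_mulVec, ← hy, dotProduct_smul, smul_eq_mul]
  have h2 : star x ⬝ᵥ y = conj (star y ⬝ᵥ x) := by
    rw [← RCLike.star_def, Matrix.star_dotProduct]
  have h3 : 0 ≤ star y ⬝ᵥ y := dotProduct_star_self_nonneg y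
  rw [Complex.nonneg_iff] at h3
  have h4 : ((1 - κ * u ^ 2) * conj (star y ⬝ᵥ x)).re =
      (conj (1 - κ * u ^ 2) * (star y ⬝ᵥ x)).re := by
    rw [← Complex.conj_re, map_mul, Complex.conj_conj]
  rw [h2, h4, h1, ← mul_assoc, Complex.mul_re, ← h3.2, mul_zero, sub_zero]
  exact mul_nonneg (re_conj_mul_pos hκ hκ1 hm hu).le h3.1

theorem dicksonGenerating_eq (hκ : 0 ≤ κ) (hκ1 : κ < 1)
    (hM : ∀ v : Fin n → ℂ, ∃ m ∈ joukowskiRegion κ 1, star v ⬝ᵥ (M *ᵥ v) = m * (star v ⬝ᵥ v))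
    {u : ℂ} (hu : ‖u‖ < 1) :
    dicksonGenerating κ M u = (1 - κ * u ^ 2) • (1 : Matrix (Fin n) (Fin n) ℂ) +
      u • (M * dicksonGenerating κ M u) - (κ * u ^ 2) • dicksonGenerating κ M u := by
  have h1 := Matrix.mul_nonsing_inv _ (isUnit_denominator hκ hκ1 hM hu)
  have h2 : ((1 + κ * u ^ 2) • (1 : Matrix (Fin n) (Fin n) ℂ) - u • M) * dicksonGenerating κ M u =
      (1 - κ * u ^ 2) • (1 : Matrix (Fin n) (Fin n) ℂ) := by
    rw [dicksonGenerating, Matrix.mul_smul, h1]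
  rw [← h2, Matrix.sub_mul, Matrix.smul_mul, Matrix.smul_mul, Matrix.one_mul, add_smul, one_smul]
  abel

theorem differentiableOn_dicksonGenerating (hκ : 0 ≤ κ) (hκ1 : κ < 1)
    (hM : ∀ v : Fin n → ℂ, ∃ m ∈ joukowskiRegion κ 1, star v ⬝ᵥ (M *ᵥ v) = m * (star v ⬝ᵥ v))
    (k l : Fin n) :
    DifferentiableOn ℂ (fun u => dicksonGenerating κ M u k l) (Metric.ball 0 1) := by
  have hN : ∀ i j, Differentiable ℂ
      (fun u : ℂ => ((1 + κ * u ^ 2) • (1 : Matrix (Fin n) (Fin n) ℂ) - u • M) i j) := fun i j => by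
    simp only [Matrix.sub_apply, Matrix.smul_apply, smul_eq_mul]
    fun_prop
  have hdet : ∀ N : ℂ → Matrix (Fin n) (Fin n) ℂ, (∀ i j, Differentiable ℂ (fun u => N u i j)) →
      Differentiable ℂ (fun u => (N u).det) := fun N h => by
    simp only [Matrix.det_apply]
    refine Differentiable.fun_sum fun σ _ => ?_
    refine Differentiable.const_smul ?_ _
    exact Differentiable.fun_finsetProd fun i _ => h _ _
  have hadj : Differentiable ℂ (fun u : ℂ =>
      ((1 + κ * u ^ 2) • (1 : Matrix (Fin n) (Fin n) ℂ) - u • M).adjugate k l) := by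
    simp only [Matrix.adjugate_apply]
    refine hdet _ fun i j => ?_
    by_cases h : i = l
    · subst h; simp only [Matrix.updateRow_self]; fun_prop
    · simp only [Matrix.updateRow_ne h]; exact hN i j
  simp only [dicksonGenerating, Matrix.inv_def, Ring.inverse_eq_inv', Matrix.smul_apply, smul_eq_mul]
  refine DifferentiableOn.mul (by fun_prop) (DifferentiableOn.mul ?_ hadj.differentiableOn)
  refine DifferentiableOn.inv (hdet _ hN).differentiableOn fun u hu => ?_
  exact (isUnit_denominator hκ hκ1 hM (by simpa using hu)).ne_zero

end Dickson

end MatrixDecay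

namespace MatrixDecay

open Set MeasureTheory Real Polynomial Filter Topology

/-! ### Dickson polynomials as Taylor coefficients, and the bound 2. -/

section Dickson

variable {n : ℕ} {κ : ℝ} {M : Matrix (Fin n) (Fin n) ℂ}

theorem dickson_one_zero (a : ℂ) : dickson 1 a 0 = C 2 := by
  rw [dickson_zero, Nat.cast_one, map_ofNat]; norm_num

theorem dicksonGenerating_zero : dicksonGenerating κ M 0 = 1 := by
  simp [dicksonGenerating]

theorem dicksonGenerating_apply (hκ : 0 ≤ κ) (hκ1 : κ < 1)
    (hM : ∀ v : Fin n → ℂ, ∃ m ∈ joukowskiRegion κ 1, star v ⬝ᵥ (M *ᵥ v) = m * (star v ⬝ᵥ v))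
    {u : ℂ} (hu : ‖u‖ < 1) (k l : Fin n) :
    dicksonGenerating κ M u k l = (1 - κ * u ^ 2) * (1 : Matrix (Fin n) (Fin n) ℂ) k l +
      u * ∑ i, M k i * dicksonGenerating κ M u i l -
        κ * u ^ 2 * dicksonGenerating κ M u k l := by
  have h := congrFun (congrFun (dicksonGenerating_eq hκ hκ1 hM hu) k) l
  simpa [Matrix.mul_apply] using h

/-- The Dickson polynomials at `M` are the Taylor coefficients of their generating function. -/
theorem circleAverage_dicksonGenerating (hκ : 0 ≤ κ) (hκ1 : κ < 1)
    (hM : ∀ v : Fin n → ℂ, ∃ m ∈ joukowskiRegion κ 1, star v ⬝ᵥ (M *ᵥ v) = m * (star v ⬝ᵥ v))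
    {r : ℝ} (hr : 0 < r) (hr1 : r < 1) (j : ℕ) : ∀ k l,
    circleAverage (fun u => (u⁻¹) ^ (j + 1) * dicksonGenerating κ M u k l) 0 r =
      (aeval M (dickson 1 (κ : ℂ) (j + 1))) k l := by
  have hd : ∀ k l, DiffContOnCl ℂ (fun u => dicksonGenerating κ M u k l) (Metric.ball 0 r) := by
    intro k l
    refine DifferentiableOn.diffContOnCl ?_
    rw [closure_ball _ hr.ne']
    exact (differentiableOn_dicksonGenerating hκ hκ1 hM k l).mono
      (Metric.closedBall_subset_ball hr1)
  have hc : ∀ k l, ContinuousOn (fun u => dicksonGenerating κ M u k l) (Metric.sphere 0 r) :=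
    fun k l => (differentiableOn_dicksonGenerating hκ hκ1 hM k l).continuousOn.mono
      (Metric.sphere_subset_closedBall.trans (Metric.closedBall_subset_ball hr1))
  have hne : ∀ u ∈ Metric.sphere (0 : ℂ) r, u ≠ 0 := fun u hu => by
    rw [mem_sphere_zero_iff_norm] at hu
    exact norm_pos_iff.1 (hu ▸ hr)
  have hlt : ∀ u ∈ Metric.sphere (0 : ℂ) r, ‖u‖ < 1 := fun u hu => by
    rwa [mem_sphere_zero_iff_norm.1 hu]
  have hinv : ∀ j, ContinuousOn (fun u : ℂ => (u⁻¹) ^ j) (Metric.sphere 0 r) := fun j =>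
    (ContinuousOn.inv₀ continuousOn_id hne).pow j
  have hci : ∀ j k l, CircleIntegrable
      (fun u => (u⁻¹) ^ j * dicksonGenerating κ M u k l) 0 r := fun j k l =>
    ((hinv j).mul (hc k l)).circleIntegrable hr.le
  have hcsum : ∀ j k l, CircleIntegrable
      (fun u => ∑ i, M k i • ((u⁻¹) ^ j * dicksonGenerating κ M u i l)) 0 r := fun j k l =>
    ContinuousOn.circleIntegrable hr.le
      (continuousOn_finsetSum _ fun i _ => (continuousOn_const (c := M k i)).smul ((hinv j).mul (hc i l)))
  have hG0 : ∀ k l, circleAverage (fun u => (u⁻¹) ^ 0 * dicksonGenerating κ M u k l) 0 r =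
      (1 : Matrix (Fin n) (Fin n) ℂ) k l := fun k l => by
    have h3 := DiffContOnCl.circleAverage (c := 0) (R := r) (by rw [abs_of_pos hr]; exact hd k l)
    simpa [dicksonGenerating_zero] using h3
  have hentire : ∀ f : ℂ → ℂ, DiffContOnCl ℂ f (Metric.ball 0 r) → circleAverage f 0 r = f 0 :=
    fun f hf => DiffContOnCl.circleAverage (by rwa [abs_of_pos hr])
  have hsum : ∀ j k l, circleAverage
      (fun u => ∑ i, M k i • ((u⁻¹) ^ j * dicksonGenerating κ M u i l)) 0 r =
      ∑ i, M k i * circleAverage (fun u => (u⁻¹) ^ j * dicksonGenerating κ M u i l) 0 r := by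
    intro j k l
    have hi : ∀ i, CircleIntegrable
        (fun u => M k i • ((u⁻¹) ^ j * dicksonGenerating κ M u i l)) 0 r :=
      fun i => (hci j i l).const_smul
    rw [circleAverage_fun_sum fun i _ => hi i]
    exact Finset.sum_congr rfl fun i _ => circleAverage_fun_smul
  have hone : ∀ k l,
      circleAverage (fun u => (u⁻¹) ^ 1 * dicksonGenerating κ M u k l) 0 r = M k l := by
    intro k l
    have hB : DiffContOnCl ℂ (fun u : ℂ => κ * u * (1 : Matrix (Fin n) (Fin n) ℂ) k l +
        κ * u * dicksonGenerating κ M u k l) (Metric.ball 0 r) :=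
      (Differentiable.diffContOnCl (by fun_prop)).add
        ((Differentiable.diffContOnCl (f := fun u : ℂ => κ * u) (by fun_prop)).smul (hd k l))
    have hBi : CircleIntegrable (fun u : ℂ => κ * u * (1 : Matrix (Fin n) (Fin n) ℂ) k l +
        κ * u * dicksonGenerating κ M u k l) 0 r :=
      ContinuousOn.circleIntegrable hr.le (by have := hc k l; fun_prop)
    have hAi : CircleIntegrable
        (fun u : ℂ => (1 : Matrix (Fin n) (Fin n) ℂ) k l • (u⁻¹) ^ 1) 0 r :=
      ContinuousOn.circleIntegrable hr.le ((continuousOn_const (c := (1 : Matrix (Fin n) (Fin n) ℂ) k l)).smul (hinv 1))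
    have h1 : circleAverage (fun u => (u⁻¹) ^ 1 * dicksonGenerating κ M u k l) 0 r =
        circleAverage (fun u => ((1 : Matrix (Fin n) (Fin n) ℂ) k l • (u⁻¹) ^ 1 +
          ∑ i, M k i • ((u⁻¹) ^ 0 * dicksonGenerating κ M u i l)) -
          (κ * u * (1 : Matrix (Fin n) (Fin n) ℂ) k l +
            κ * u * dicksonGenerating κ M u k l)) 0 r := by
      apply circleAverage_congr_sphere
      intro u hu
      rw [abs_of_pos hr] at hu
      have h0 := hne u hu
      have h2 := dicksonGenerating_apply hκ hκ1 hM (hlt u hu) k l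
      simp only [smul_eq_mul, pow_zero, pow_one, one_mul]
      rw [← mul_right_inj' h0]
      simp only [mul_sub, mul_add, mul_inv_cancel_left₀ h0]
      linear_combination h2 - (1 : Matrix (Fin n) (Fin n) ℂ) k l * mul_inv_cancel₀ h0
    have hABi : CircleIntegrable (fun u => (1 : Matrix (Fin n) (Fin n) ℂ) k l • (u⁻¹) ^ 1 +
        ∑ i, M k i • ((u⁻¹) ^ 0 * dicksonGenerating κ M u i l)) 0 r := hAi.add (hcsum 0 k l)
    rw [h1, circleAverage_fun_sub hABi hBi,
      circleAverage_fun_add hAi (hcsum 0 k l), circleAverage_fun_smul,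
      circleAverage_inv_pow hr one_ne_zero, hsum, hentire _ hB]
    simp only [hG0]
    rw [← Matrix.mul_apply, Matrix.mul_one]
    simp
  -- The constant term of the generating function is 1 while D_0 = 2. The extra -κ at j = 0, from
  -- the numerator 1 - κu², makes up the difference in D_2 = X² - 2κ.
  have hstep : ∀ j k l,
      circleAverage (fun u => (u⁻¹) ^ (j + 2) * dicksonGenerating κ M u k l) 0 r =
        -(if j = 0 then (κ : ℂ) else 0) * (1 : Matrix (Fin n) (Fin n) ℂ) k l +
        ∑ i, M k i * circleAverage (fun u => (u⁻¹) ^ (j + 1) * dicksonGenerating κ M u i l) 0 r -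
        κ * circleAverage (fun u => (u⁻¹) ^ j * dicksonGenerating κ M u k l) 0 r := by
    intro j k l
    have hAi : CircleIntegrable
        (fun u : ℂ => (1 : Matrix (Fin n) (Fin n) ℂ) k l • (u⁻¹) ^ (j + 2)) 0 r :=
      ContinuousOn.circleIntegrable hr.le ((continuousOn_const (c := (1 : Matrix (Fin n) (Fin n) ℂ) k l)).smul (hinv (j + 2)))
    have hA'i : CircleIntegrable
        (fun u : ℂ => (κ * (1 : Matrix (Fin n) (Fin n) ℂ) k l) • (u⁻¹) ^ j) 0 r :=
      ContinuousOn.circleIntegrable hr.le ((continuousOn_const (c := κ * (1 : Matrix (Fin n) (Fin n) ℂ) k l)).smul (hinv j))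
    have hBi : CircleIntegrable (fun u : ℂ => (κ : ℂ) • ((u⁻¹) ^ j *
        dicksonGenerating κ M u k l)) 0 r := (hci j k l).const_smul
    have h1 : circleAverage (fun u => (u⁻¹) ^ (j + 2) * dicksonGenerating κ M u k l) 0 r =
        circleAverage (fun u => (((1 : Matrix (Fin n) (Fin n) ℂ) k l • (u⁻¹) ^ (j + 2) -
          (κ * (1 : Matrix (Fin n) (Fin n) ℂ) k l) • (u⁻¹) ^ j) +
          ∑ i, M k i • ((u⁻¹) ^ (j + 1) * dicksonGenerating κ M u i l)) -
          (κ : ℂ) • ((u⁻¹) ^ j * dicksonGenerating κ M u k l)) 0 r := by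
      apply circleAverage_congr_sphere
      intro u hu
      rw [abs_of_pos hr] at hu
      have h0 := hne u hu
      have h2 := dicksonGenerating_apply hκ hκ1 hM (hlt u hu) k l
      have h3 : ∑ i, M k i • ((u⁻¹) ^ (j + 1) * dicksonGenerating κ M u i l) =
          (u⁻¹) ^ (j + 1) * ∑ i, M k i * dicksonGenerating κ M u i l := by
        rw [Finset.mul_sum]
        exact Finset.sum_congr rfl fun i _ => mul_left_comm _ _ _
      have e1 : (u⁻¹) ^ (j + 1) = (u⁻¹) ^ (j + 2) * u := by
        rw [pow_succ _ (j + 1), inv_mul_cancel_right₀ h0]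
      have e2 : (u⁻¹) ^ j = (u⁻¹) ^ (j + 2) * u ^ 2 := by
        rw [sq, ← mul_assoc, ← e1, pow_succ, inv_mul_cancel_right₀ h0]
      beta_reduce
      rw [h3]
      simp only [smul_eq_mul]
      rw [e1, e2]
      linear_combination (u⁻¹) ^ (j + 2) * h2
    have hAAi : CircleIntegrable (fun u => (1 : Matrix (Fin n) (Fin n) ℂ) k l • (u⁻¹) ^ (j + 2) -
        (κ * (1 : Matrix (Fin n) (Fin n) ℂ) k l) • (u⁻¹) ^ j) 0 r := hAi.sub hA'i
    have hABi : CircleIntegrable (fun u => (1 : Matrix (Fin n) (Fin n) ℂ) k l • (u⁻¹) ^ (j + 2) -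
        (κ * (1 : Matrix (Fin n) (Fin n) ℂ) k l) • (u⁻¹) ^ j +
        ∑ i, M k i • ((u⁻¹) ^ (j + 1) * dicksonGenerating κ M u i l)) 0 r :=
      hAAi.add (hcsum (j + 1) k l)
    rw [h1, circleAverage_fun_sub hABi hBi, circleAverage_fun_add hAAi (hcsum (j + 1) k l), circleAverage_fun_sub hAi hA'i,
      circleAverage_fun_smul, circleAverage_fun_smul, circleAverage_fun_smul,
      circleAverage_inv_pow hr (by omega), hsum]
    simp only [smul_eq_mul, mul_zero, zero_sub]
    congr 2
    rcases eq_or_ne j 0 with rfl | hj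
    · simp [circleAverage_const]
    · rw [circleAverage_inv_pow hr hj, if_neg hj]; simp
  induction j using Nat.strong_induction_on with
  | _ j ih =>
  intro k l
  rcases j with _ | _ | j
  · simpa using hone k l
  · rw [hstep 0 k l]
    simp only [zero_add, hone, hG0]
    rw [dickson_add_two, dickson_one, dickson_one_zero, ← Matrix.mul_apply]
    simp only [map_sub, map_mul, aeval_X, aeval_C, Matrix.sub_apply, Algebra.algebraMap_eq_smul_one,
      Matrix.smul_mul, Matrix.one_mul, Matrix.smul_apply, smul_eq_mul, if_true]
    ring
  · rw [hstep (j + 1) k l, dickson_add_two]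
    simp only [ih (j + 1) (by omega), ih j (by omega)]
    rw [← Matrix.mul_apply]
    simp [Algebra.algebraMap_eq_smul_one]

/-- Beckermann's bound for the Faber polynomials of an ellipse containing the numerical range, in
terms of entries. -/
theorem norm_aeval_dickson_le (hκ : 0 ≤ κ) (hκ1 : κ < 1)
    (hM : ∀ v : Fin n → ℂ, ∃ m ∈ joukowskiRegion κ 1, star v ⬝ᵥ (M *ᵥ v) = m * (star v ⬝ᵥ v))
    (j : ℕ) (k l : Fin n) : ‖(aeval M (dickson 1 (κ : ℂ) j)) k l‖ ≤ 2 := by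
  rcases j with _ | j
  · rw [dickson_one_zero, aeval_C, Algebra.algebraMap_eq_smul_one, Matrix.smul_apply, smul_eq_mul, norm_mul,
      Matrix.one_apply]
    split_ifs <;> simp
  -- Carathéodory on |u| = r gives 2r^(-j-1) for every r < 1; let r → 1.
  · have ht : Tendsto (fun r : ℝ => 2 * (r⁻¹) ^ (j + 1)) (𝓝[<] 1) (𝓝 2) := by
      have : ContinuousAt (fun r : ℝ => 2 * (r⁻¹) ^ (j + 1)) 1 := by
        refine ContinuousAt.mul continuousAt_const (ContinuousAt.pow ?_ _)
        exact continuousAt_inv₀ one_ne_zero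
      have h2 := this.tendsto
      simp only [inv_one, one_pow, mul_one] at h2
      exact h2.mono_left nhdsWithin_le_nhds
    refine ge_of_tendsto ht ?_
    filter_upwards [Ioo_mem_nhdsLT (zero_lt_one (α := ℝ))] with r hr
    rw [← circleAverage_dicksonGenerating hκ hκ1 hM hr.1 hr.2]
    refine norm_circleAverage_inv_pow_mul_le hr.1 (fun k l => ?_) dicksonGenerating_zero
      (fun u hu x => dicksonGenerating_re_nonneg hκ hκ1 hM ?_ x) (Nat.succ_ne_zero j) k l
    · refine DifferentiableOn.diffContOnCl ?_
      rw [closure_ball _ hr.1.ne']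
      exact (differentiableOn_dicksonGenerating hκ hκ1 hM k l).mono
        (Metric.closedBall_subset_ball hr.2)
    · rw [mem_sphere_zero_iff_norm.1 hu]; exact hr.2

end Dickson

end MatrixDecay

namespace MatrixDecay

open Set MeasureTheory Real

/-! ### Termwise integration and elliptical contours. -/

theorem Contour.hasSum_integral (Γ : Contour) {ι : Type*} [Countable ι] {F : ι → ℂ → ℂ}
    {f : ℂ → ℂ} {bound : ι → ℝ} (hF : ∀ i, ContinuousOn (F i) Γ.trace)
    (hbound : ∀ i, ∀ z ∈ Γ.trace, ‖F i z‖ ≤ bound i) (hsum : Summable bound)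
    (hf : ∀ z ∈ Γ.trace, HasSum (fun i => F i z) (f z)) :
    HasSum (fun i => Γ.integral (F i)) (Γ.integral f) := by
  refine hasSum_sum fun m _ => ?_
  obtain ⟨K, hK⟩ := isCompact_Icc.exists_bound_of_continuousOn
    ((Γ.contDiffOn m).continuousOn_derivWithin (uniqueDiffOn_Icc zero_lt_one) le_rfl)
  have hae : ∀ᵐ t ∂volume, t ∈ uIoc (0 : ℝ) 1 → t ∈ Ioo (0 : ℝ) 1 := by
    have h1 : ∀ᵐ t : ℝ ∂volume, t ≠ 1 := by simp [ae_iff]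
    filter_upwards [h1] with t ht ht'
    rw [uIoc_of_le zero_le_one] at ht'
    exact ⟨ht'.1, lt_of_le_of_ne ht'.2 ht⟩
  refine intervalIntegral.hasSum_integral_of_dominated_convergence (fun i _ => bound i * K)
    (fun i => ?_) (fun i => ?_) ?_ ?_ ?_
  · rw [uIoc_of_le zero_le_one]
    exact (Γ.intervalIntegrable m (hF i)).aestronglyMeasurable
  · filter_upwards [hae] with t ht ht'
    have h1 := ht ht'
    have hK' := hK t (Ioo_subset_Icc_self h1)
    rw [Contour.deriv_eq_derivWithin _ t h1] at hK'
    have hm := hbound i _ (Γ.curve_mem_trace m (Ioo_subset_Icc_self h1))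
    rw [norm_mul]
    exact mul_le_mul hm hK' (norm_nonneg _) ((norm_nonneg _).trans hm)
  · exact Filter.Eventually.of_forall fun t _ => hsum.mul_right K
  · exact intervalIntegrable_const
  · filter_upwards [hae] with t ht ht'
    exact (hf _ (Γ.curve_mem_trace m (Ioo_subset_Icc_self (ht ht')))).mul_right _

section EllipseContour

variable (c : ℂ) (R κ : ℝ) {r : ℝ}

/-- The Joukowski parametrization `w ↦ c + R (w + κ / w)`. -/
noncomputable def joukowski (w : ℂ) : ℂ := c + R * (w + κ / w)

theorem hasDerivAt_joukowski {w : ℂ} (hw : w ≠ 0) :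
    HasDerivAt (joukowski c R κ) (R * (1 - κ / w ^ 2)) w := by
  have h := (((hasDerivAt_id w).add ((hasDerivAt_inv hw).const_mul (κ : ℂ))).const_mul
    (R : ℂ)).const_add c
  refine (h.congr_deriv (by ring)).congr_of_eventuallyEq (Filter.Eventually.of_forall fun z => ?_)
  simp [joukowski, div_eq_mul_inv]

theorem circleMap_zero_ne_zero (hr : 0 < r) (θ : ℝ) : circleMap 0 r θ ≠ 0 :=
  circleMap_ne_center hr.ne'

theorem hasDerivAt_joukowski_circleMap (hr : 0 < r) (t : ℝ) :
    HasDerivAt (fun t : ℝ => joukowski c R κ (circleMap 0 r (2 * π * t)))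
      (R * (1 - κ / circleMap 0 r (2 * π * t) ^ 2) *
        (2 * π * deriv (circleMap 0 r) (2 * π * t))) t := by
  have h1 : HasDerivAt (fun t : ℝ => circleMap 0 r (2 * π * t))
      ((2 * π) • (circleMap 0 r (2 * π * t) * Complex.I)) t := by
    have := (hasDerivAt_circleMap 0 r (2 * π * t)).scomp t ((hasDerivAt_id t).const_mul (2 * π))
    simpa [Function.comp_def] using this
  refine (HasDerivAt.comp (h := fun t : ℝ => circleMap 0 r (2 * π * t)) t
    (hasDerivAt_joukowski c R κ (circleMap_zero_ne_zero hr _)) h1).congr_deriv ?_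
  simp [deriv_circleMap]

/-- The ellipse that is the image of the circle of radius `r` under `joukowski c R κ`. -/
noncomputable def ellipseContour (hr : 0 < r) : Contour where
  size := 1
  curve _ t := joukowski c R κ (circleMap 0 r (2 * π * t))
  contDiffOn _ := by
    have h1 : ContDiff ℝ 1 (fun t : ℝ => circleMap 0 r (2 * π * t)) :=
      (contDiff_circleMap 0 r).comp (contDiff_const.mul contDiff_id)
    refine ContDiff.contDiffOn ?_
    exact contDiff_const.add (contDiff_const.mul (h1.add (contDiff_const.mul
      (h1.inv fun t => circleMap_zero_ne_zero hr _))))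
  closed _ := by
    have := periodic_circleMap 0 r 0
    rw [zero_add] at this
    simp [this]

theorem mem_trace_ellipseContour (hr : 0 < r) {z : ℂ} (hz : z ∈ (ellipseContour c R κ hr).trace) :
    ∃ w, ‖w‖ = r ∧ joukowski c R κ w = z := by
  obtain ⟨i, hi⟩ := mem_iUnion.1 hz
  obtain ⟨t, -, rfl⟩ := hi
  exact ⟨circleMap 0 r (2 * π * t), by simp [abs_of_pos hr], rfl⟩

theorem integral_ellipseContour (hr : 0 < r) (g : ℂ → ℂ) :
    (ellipseContour c R κ hr).integral g =
      ∮ w in C(0, r), g (joukowski c R κ w) * (R * (1 - κ / w ^ 2)) := by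
  have h1 : (ellipseContour c R κ hr).integral g = ∫ t in (0 : ℝ)..1,
      g (joukowski c R κ (circleMap 0 r (2 * π * t))) *
        deriv (fun t : ℝ => joukowski c R κ (circleMap 0 r (2 * π * t))) t := by
    simp only [Contour.integral, ellipseContour]
    exact Fin.sum_univ_one _
  rw [h1, circleIntegral]
  have h2 := intervalIntegral.integral_comp_mul_left (a := 0) (b := 1)
    (fun θ => deriv (circleMap 0 r) θ • (g (joukowski c R κ (circleMap 0 r θ)) *
      (R * (1 - κ / circleMap 0 r θ ^ 2)))) (c := 2 * π) Real.two_pi_pos.ne'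
  rw [mul_zero, mul_one, eq_inv_smul_iff₀ Real.two_pi_pos.ne', ← intervalIntegral.integral_smul] at h2
  rw [← h2]
  refine intervalIntegral.integral_congr fun t _ => ?_
  simp only [(hasDerivAt_joukowski_circleMap c R κ hr t).deriv]
  simp
  ring

theorem circleIntegral_sub_inv_of_lt {u : ℂ} (hr : 0 < r) (hu : r < ‖u‖) :
    (∮ w in C(0, r), (w - u)⁻¹) = 0 := by
  have hd : DifferentiableOn ℂ (fun w : ℂ => (w - u)⁻¹) (Metric.closedBall 0 r) := by
    intro w hw
    have h0 : w - u ≠ 0 := fun h => by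
      rw [sub_eq_zero] at h
      rw [mem_closedBall_zero_iff, h] at hw
      linarith
    have hd : DifferentiableAt ℂ (fun w : ℂ => w - u) w := by fun_prop
    exact (hd.inv h0).differentiableWithinAt
  refine (DifferentiableOn.diffContOnCl (f := fun w : ℂ => (w - u)⁻¹)
    (s := Metric.ball 0 r) ?_).circleIntegral_eq_zero hr.le
  rwa [closure_ball _ hr.ne']

/-- Pulled back to the circle, z - p = R(w-u₁)(w-u₂)/w. The logarithmic derivative has simple poles
at both preimages of p, and the pole at w = 0 accounts for the -1. -/
theorem windingNumber_ellipseContour (hr : 0 < r) (hR : 0 < R) {p u₁ u₂ : ℂ}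
    (hadd : u₁ + u₂ = (p - c) / R) (hmul : u₁ * u₂ = κ) (h₁ : ‖u₁‖ ≠ r) (h₂ : ‖u₂‖ ≠ r) :
    (ellipseContour c R κ hr).windingNumber p =
      (2 * π * Complex.I)⁻¹ *
        ((∮ w in C(0, r), (w - u₁)⁻¹) + (∮ w in C(0, r), (w - u₂)⁻¹)) - 1 := by
  have hR0 : (R : ℂ) ≠ 0 := by exact_mod_cast hR.ne'
  have hne : ∀ u : ℂ, ‖u‖ ≠ r → ∀ w ∈ Metric.sphere (0 : ℂ) r, w - u ≠ 0 := by
    intro u hu w hw h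
    rw [sub_eq_zero] at h
    rw [mem_sphere_zero_iff_norm, h] at hw
    exact hu hw
  have hi : ∀ u : ℂ, ‖u‖ ≠ r → CircleIntegrable (fun w => (w - u)⁻¹) 0 r := fun u hu =>
    ContinuousOn.circleIntegrable hr.le (ContinuousOn.inv₀ (by fun_prop) (hne u hu))
  have h0 : ‖(0 : ℂ)‖ ≠ r := by simpa using hr.ne
  have key : (∮ w in C(0, r), (joukowski c R κ w - p)⁻¹ * (R * (1 - κ / w ^ 2))) =
      ∮ w in C(0, r), ((w - u₁)⁻¹ + (w - u₂)⁻¹) - (w - 0)⁻¹ := by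
    refine circleIntegral.integral_congr hr.le fun w hw => ?_
    have hw0 : w ≠ 0 := by simpa using hne 0 h0 w hw
    have hw1 := hne u₁ h₁ w hw
    have hw2 := hne u₂ h₂ w hw
    have e1 : joukowski c R κ w - p = R * ((w - u₁) * (w - u₂) / w) := by
      rw [eq_div_iff hR0] at hadd
      rw [joukowski, ← hmul]
      field_simp
      linear_combination w * hadd
    rw [e1, ← hmul, sub_zero]
    field_simp
    ring
  have hi12 : CircleIntegrable (fun w => (w - u₁)⁻¹ + (w - u₂)⁻¹) 0 r := (hi u₁ h₁).add (hi u₂ h₂)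
  rw [Contour.windingNumber, integral_ellipseContour, key,
    circleIntegral.integral_sub hi12 (hi 0 h0), circleIntegral.integral_add (hi u₁ h₁) (hi u₂ h₂),
    circleIntegral.integral_sub_inv_of_mem_ball (w := 0) (by simpa using hr), mul_sub,
    inv_mul_cancel₀ two_pi_I_ne_zero]

end EllipseContour

/-! ### Polynomials under the functional calculus. -/

section FunctionalCalculus

open Polynomial

variable {n : ℕ} {A : Matrix (Fin n) (Fin n) ℂ} {Γ : Contour}

theorem resolventIntegral_eval (hΓ : Γ.Encircles Complex.slitPlane (spectrum ℂ A)) (c s : ℂ)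
    (P : ℂ[X]) :
    resolventIntegral Γ A (fun z => P.eval (s * (z - c))) =
      aeval (s • (A - c • (1 : Matrix (Fin n) (Fin n) ℂ))) P := by
  have hdis : Disjoint Γ.trace (spectrum ℂ A) := (subset_sdiff.1 hΓ.1).2
  have hdiff : ∀ P : ℂ[X], Differentiable ℂ (fun z => P.eval (s * (z - c))) := fun P =>
    P.differentiable.comp (by fun_prop)
  induction P using Polynomial.induction_on with
  | C a =>
    have := resolventIntegral_const_mul (Γ := Γ) (A := A) a (fun _ => 1)
    rw [resolventIntegral_one hdis hΓ.2.1] at this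
    simpa [Algebra.algebraMap_eq_smul_one] using this
  | add p q hp hq =>
    simp only [eval_add, map_add, ← hp, ← hq]
    exact resolventIntegral_add hdis (hdiff p).continuous.continuousOn
      (hdiff q).continuous.continuousOn
  | monomial m a ih =>
    have h1 : resolventIntegral Γ A (fun z => (C a * X ^ (m + 1)).eval (s * (z - c))) =
        resolventIntegral Γ A (fun z => s * ((z - c) * (C a * X ^ m).eval (s * (z - c)))) :=
      resolventIntegral_congr fun z _ => by
        simp only [eval_mul, eval_pow, eval_X, eval_C]; ring
    rw [h1, resolventIntegral_const_mul, resolventIntegral_mul Γ hΓ (hdiff _).differentiableOn, ih,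
      ← Matrix.smul_mul, pow_succ', mul_left_comm, map_mul (aeval _) X, aeval_X]

end FunctionalCalculus

end MatrixDecay

/-! ### Expansion of the inverse square root. -/

namespace MatrixDecay

open Set Polynomial

/-- The coefficients of (1-x)^(-1/2) are products of (k + 1/2)/(k + 1) over k < n. -/
theorem norm_choose_half_le (n : ℕ) : ‖Ring.choose ((2⁻¹ : ℂ) + n - 1) n‖ ≤ 1 := by
  have h : ∀ n : ℕ, ‖(ascPochhammer ℕ n).smeval (2⁻¹ : ℂ)‖ ≤ n.factorial := by
    intro n
    induction n with
    | zero => simp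
    | succ n ih =>
      rw [ascPochhammer_succ_right, smeval_mul, norm_mul, Nat.factorial_succ, mul_comm]
      push_cast
      refine mul_le_mul ?_ ih (norm_nonneg _) (by positivity)
      rw [smeval_add, smeval_X, smeval_natCast, pow_one]
      refine (norm_add_le _ _).trans ?_
      simp
      linarith
  rw [← Ring.multichoose_eq]
  have h1 := h n
  rw [← Ring.factorial_nsmul_multichoose_eq_ascPochhammer, nsmul_eq_mul, norm_mul,
    Complex.norm_natCast] at h1
  have : (0 : ℝ) < n.factorial := by exact_mod_cast n.factorial_pos
  exact le_of_mul_le_mul_left (by linarith) this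

theorem exists_inv_sqrt_series : ∃ (α : ℕ → ℂ) (g : ℂ → ℂ), (∀ n, ‖α n‖ ≤ 1) ∧
    ContinuousOn g (Metric.ball 0 1) ∧ ∀ x ∈ Metric.ball (0 : ℂ) 1,
      HasSum (fun n => α n * x ^ n) (g x) ∧ g x ^ 2 * (1 - x) = 1 := by
  refine ⟨fun n => Ring.choose ((2⁻¹ : ℂ) + n - 1) n, fun x => 1 / (1 - x) ^ (2⁻¹ : ℂ),
    norm_choose_half_le, ?_, fun x hx => ⟨?_, ?_⟩⟩
  · have h := (Complex.one_div_one_sub_cpow_hasFPowerSeriesOnBall_zero 2⁻¹).continuousOn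
    rwa [← ENNReal.ofReal_one, Metric.eball_ofReal] at h
  · have h := (Complex.one_div_one_sub_cpow_hasFPowerSeriesOnBall_zero 2⁻¹).hasSum (y := x)
      (by rwa [← ENNReal.ofReal_one, Metric.eball_ofReal])
    simpa [FormalMultilinearSeries.ofScalars_apply_eq, mul_comm] using h
  · have h1 : 1 - x ≠ 0 := fun h => by
      rw [sub_eq_zero] at h; simp [← h] at hx
    rw [div_pow, ← Complex.cpow_nat_mul]
    simp [h1]

theorem eval_dickson_add {w v κ : ℂ} (h : w * v = κ) (j : ℕ) :
    (dickson 1 κ j).eval (w + v) = w ^ j + v ^ j := by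
  induction j using Nat.strong_induction_on with
  | _ j ih =>
  rcases j with _ | _ | j
  · rw [dickson_one_zero, eval_C]; norm_num
  · simp
  · rw [dickson_add_two]
    simp only [eval_sub, eval_mul, eval_X, eval_C]
    rw [ih (j + 1) (by omega), ih j (by omega), ← h]
    ring

/-- A single term (w/w₁)^p (w₂/w)^q is generally not a function of z, but its sum with the swapped
term is invariant under w ↔ κ/w. In truncated subtraction `(p - q) + (q - p)` is |p-q|. -/
theorem mul_eval_dickson {w w₁ w₂ κ : ℂ} (hw : w ≠ 0) (hw₁ : w₁ ≠ 0) (h : w₁ * w₂ = κ) (p q : ℕ) :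
    (w₁⁻¹) ^ (p + q) * κ ^ (min p q) * (dickson 1 κ ((p - q) + (q - p))).eval (w + κ / w) =
      (w / w₁) ^ p * (w₂ / w) ^ q + (w / w₁) ^ q * (w₂ / w) ^ p := by
  have key : ∀ p d : ℕ, (w₁⁻¹) ^ (p + (p + d)) * κ ^ p * (w ^ d + (κ / w) ^ d) =
      (w / w₁) ^ p * (w₂ / w) ^ (p + d) + (w / w₁) ^ (p + d) * (w₂ / w) ^ p := by
    intro p d
    subst h
    simp only [div_pow, mul_pow, pow_add, inv_pow]
    field_simp
    ring
  rw [eval_dickson_add (by field_simp)]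
  rcases le_total p q with hpq | hpq
  · obtain ⟨d, rfl⟩ := Nat.exists_eq_add_of_le hpq
    rw [min_eq_left hpq, ← key]
    simp
  · obtain ⟨d, rfl⟩ := Nat.exists_eq_add_of_le hpq
    rw [min_eq_right hpq, add_comm ((w / w₁) ^ (q + d) * _), ← key]
    simp [add_comm]

theorem hasSum_mul_symm {f g : ℕ → ℂ} {a b : ℂ} (hf : HasSum f a) (hg : HasSum g b)
    (hf' : Summable fun n => ‖f n‖) (hg' : Summable fun n => ‖g n‖) :
    HasSum (fun x : ℕ × ℕ => (f x.1 * g x.2 + f x.2 * g x.1) / 2) (a * b) := by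
  have hs : Summable fun x : ℕ × ℕ => f x.1 * g x.2 := summable_mul_of_summable_norm hf' hg'
  have h1 : HasSum (fun x : ℕ × ℕ => f x.1 * g x.2) (a * b) := HasSum.mul hf hg hs
  have h2 : HasSum (fun x : ℕ × ℕ => f x.2 * g x.1) (a * b) :=
    (Equiv.prodComm ℕ ℕ).hasSum_iff.2 h1
  have h3 := (h1.add h2).div_const 2
  rwa [add_self_div_two] at h3

/-- The expansion of `1 / √z` on an ellipse into Dickson polynomials. Here `w₁` is the exterior
preimage of the branch point `0` under `w ↦ c + R (w + κ / w)`. -/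
theorem exists_hasSum_inv_sqrt {c : ℂ} {R κ r : ℝ} (hR : 0 < R) (hr : 0 < r) {w₁ w₂ : ℂ}
    (hadd : w₁ + w₂ = -c / R) (hmul : w₁ * w₂ = κ) (h₁ : r < ‖w₁‖) (h₂ : ‖w₂‖ < r)
    (hslit : ∀ w : ℂ, ‖w‖ = r → joukowski c R κ w ∈ Complex.slitPlane) :
    ∃ (C : ℂ) (α : ℕ → ℂ), ‖C‖ ^ 2 * (R * ‖w₁‖) = 1 ∧ (∀ n, ‖α n‖ ≤ 1) ∧
      ∀ w : ℂ, ‖w‖ = r → HasSum (fun x : ℕ × ℕ => C * (α x.1 * α x.2 / 2) *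
        ((w₁⁻¹) ^ (x.1 + x.2) * (κ : ℂ) ^ (min x.1 x.2) *
          (dickson 1 (κ : ℂ) ((x.1 - x.2) + (x.2 - x.1))).eval (w + κ / w)))
        (Complex.sqrt (joukowski c R κ w))⁻¹ := by
  obtain ⟨α, g, hα, hg, hgs⟩ := exists_inv_sqrt_series
  have hR0 : (R : ℂ) ≠ 0 := by exact_mod_cast hR.ne'
  have hw₁ : w₁ ≠ 0 := norm_pos_iff.1 (hr.trans h₁)
  have hx : ∀ w : ℂ, ‖w‖ = r → w / w₁ ∈ Metric.ball (0 : ℂ) 1 := fun w hw => by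
    rw [mem_ball_zero_iff, norm_div, hw, div_lt_one (hr.trans h₁)]
    exact h₁
  have hy : ∀ w : ℂ, ‖w‖ = r → w₂ / w ∈ Metric.ball (0 : ℂ) 1 := fun w hw => by
    rw [mem_ball_zero_iff, norm_div, hw, div_lt_one hr]
    exact h₂
  have hne : ∀ w : ℂ, ‖w‖ = r → w ≠ 0 := fun w hw => norm_pos_iff.1 (hw ▸ hr)
  set C₀ := (Complex.sqrt (-R * w₁))⁻¹ with hC₀
  have hC₀sq : C₀ ^ 2 * (-R * w₁) = 1 := by
    rw [hC₀, inv_pow, sqrt_sq]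
    exact inv_mul_cancel₀ (mul_ne_zero (neg_ne_zero.2 hR0) hw₁)
  have hC₀norm : ‖C₀‖ ^ 2 * (R * ‖w₁‖) = 1 := by
    have := congrArg norm hC₀sq
    simpa [abs_of_pos hR] using this
  have hfac : ∀ w : ℂ, ‖w‖ = r →
      joukowski c R κ w = (-R * w₁) * ((1 - w / w₁) * (1 - w₂ / w)) := fun w hw => by
    have h0 := hne w hw
    rw [eq_div_iff hR0] at hadd
    rw [joukowski, ← hmul]
    field_simp
    linear_combination w * hadd
  have hsq : ∀ w : ℂ, ‖w‖ = r →
      (C₀ * (g (w / w₁) * g (w₂ / w))) ^ 2 * joukowski c R κ w = 1 := fun w hw => by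
    rw [hfac w hw]
    calc _ = (C₀ ^ 2 * (-R * w₁)) * (g (w / w₁) ^ 2 * (1 - w / w₁)) *
          (g (w₂ / w) ^ 2 * (1 - w₂ / w)) := by ring
      _ = 1 := by rw [hC₀sq, (hgs _ (hx w hw)).2, (hgs _ (hy w hw)).2]; norm_num
  have hsqrt0 : ∀ w : ℂ, ‖w‖ = r → Complex.sqrt (joukowski c R κ w) ≠ 0 := fun w hw h => by
    simpa [h] using sqrt_re_pos (hslit w hw)
  have hsph : ∀ w ∈ Metric.sphere (0 : ℂ) r, ‖w‖ = r := fun w hw => mem_sphere_zero_iff_norm.1 hw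
  have hj : ContinuousOn (joukowski c R κ) (Metric.sphere 0 r) := fun w hw =>
    (hasDerivAt_joukowski c R κ (hne w (hsph w hw))).continuousAt.continuousWithinAt
  have hcont1 : ContinuousOn (fun w => (Complex.sqrt (joukowski c R κ w))⁻¹)
      (Metric.sphere 0 r) := by
    refine ContinuousOn.inv₀ ?_ fun w hw => hsqrt0 w (hsph w hw)
    intro w hw
    exact (hasDerivAt_sqrt (hslit w (hsph w hw))).continuousAt.comp_continuousWithinAt (hj w hw)
  have hcont2 : ContinuousOn (fun w => C₀ * (g (w / w₁) * g (w₂ / w))) (Metric.sphere 0 r) := by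
    refine continuousOn_const.mul (ContinuousOn.mul ?_ ?_)
    · exact hg.comp (by fun_prop) fun w hw => hx w (hsph w hw)
    · exact hg.comp (continuousOn_const.div continuousOn_id fun w hw => hne w (hsph w hw))
        fun w hw => hy w (hsph w hw)
  -- Both continuous functions have the same square and no zeros, so on the connected circle they
  -- agree up to one global sign, absorbed into C.
  have hconn : IsPreconnected (Metric.sphere (0 : ℂ) r) :=
    isPreconnected_sphere (by rw [Complex.rank_real_complex]; exact Cardinal.one_lt_two) 0 r
  have hor := hconn.eq_or_eq_neg_of_sq_eq hcont1 hcont2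
    (fun w hw => by
      have h := hsq w (hsph w hw)
      have h0 := Complex.slitPlane_ne_zero (hslit w (hsph w hw))
      simp only [Pi.pow_apply, inv_pow, sqrt_sq]
      exact (eq_inv_of_mul_eq_one_left h).symm)
    (fun {w} hw h => by
      have h' := hsq w (hsph w hw)
      rw [h] at h'
      simp at h')
  have hsum : ∀ w : ℂ, ‖w‖ = r → HasSum (fun x : ℕ × ℕ => (α x.1 * α x.2 / 2) *
        ((w₁⁻¹) ^ (x.1 + x.2) * (κ : ℂ) ^ (min x.1 x.2) *
          (dickson 1 (κ : ℂ) ((x.1 - x.2) + (x.2 - x.1))).eval (w + κ / w)))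
        (g (w / w₁) * g (w₂ / w)) := by
    intro w hw
    have hsummable : ∀ x ∈ Metric.ball (0 : ℂ) 1, Summable (fun n => ‖α n * x ^ n‖) := by
      intro x hx
      rw [mem_ball_zero_iff] at hx
      refine Summable.of_nonneg_of_le (fun n => norm_nonneg _) (fun n => ?_)
        (summable_geometric_of_lt_one (norm_nonneg x) hx)
      rw [norm_mul, norm_pow]
      exact mul_le_of_le_one_left (by positivity) (hα n)
    convert hasSum_mul_symm (hgs _ (hx w hw)).1 (hgs _ (hy w hw)).1
      (hsummable _ (hx w hw)) (hsummable _ (hy w hw)) using 2 with x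
    rw [mul_eval_dickson (hne w hw) hw₁ hmul]
    ring
  rcases hor with h | h
  · refine ⟨C₀, α, hC₀norm, hα, fun w hw => ?_⟩
    have e := h (mem_sphere_zero_iff_norm.2 hw)
    beta_reduce at e
    rw [e]
    simpa only [mul_assoc] using (hsum w hw).mul_left C₀
  · refine ⟨-C₀, α, by rwa [norm_neg], hα, fun w hw => ?_⟩
    have e := h (mem_sphere_zero_iff_norm.2 hw)
    simp only [Pi.neg_apply] at e
    rw [e, ← neg_mul]
    simpa only [mul_assoc] using (hsum w hw).mul_left (-C₀)

end MatrixDecay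

namespace MatrixDecay

open Set Polynomial

/-! ### Bandwidth of Dickson polynomials of a banded matrix. -/

section Banded

variable {n : ℕ} {A B : Matrix (Fin n) (Fin n) ℂ} {β γ β' γ' : ℕ}

theorem IsBanded.mono (h : IsBanded β γ A) (hβ : β ≤ β') (hγ : γ ≤ γ') : IsBanded β' γ' A :=
  fun k l hkl => h k l (by omega)

theorem IsBanded.sub (hA : IsBanded β γ A) (hB : IsBanded β γ B) : IsBanded β γ (A - B) :=
  fun k l hkl => by rw [Matrix.sub_apply, hA k l hkl, hB k l hkl, sub_zero]

theorem IsBanded.smul (hA : IsBanded β γ A) (s : ℂ) : IsBanded β γ (s • A) :=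
  fun k l hkl => by rw [Matrix.smul_apply, hA k l hkl, smul_zero]

theorem isBanded_one : IsBanded 0 0 (1 : Matrix (Fin n) (Fin n) ℂ) :=
  fun k l hkl => Matrix.one_apply_ne (by rintro rfl; omega)

theorem IsBanded.mul (hA : IsBanded β γ A) (hB : IsBanded β' γ' B) :
    IsBanded (β + β') (γ + γ') (A * B) := fun k l hkl => by
  rw [Matrix.mul_apply]
  refine Finset.sum_eq_zero fun i _ => ?_
  by_cases h : (i : ℤ) - (k : ℤ) > β ∨ (k : ℤ) - (i : ℤ) > γ
  · rw [hA k i h, zero_mul]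
  · rw [hB i l (by push_cast at hkl; omega), mul_zero]

theorem IsBanded.aeval_dickson (hA : IsBanded β γ A) (κ : ℂ) (j : ℕ) :
    IsBanded (j * β) (j * γ) (aeval A (dickson 1 κ j)) := by
  induction j using Nat.strong_induction_on with
  | _ j ih =>
  rcases j with _ | _ | j
  · rw [dickson_one_zero, aeval_C, Algebra.algebraMap_eq_smul_one]
    exact (isBanded_one.smul 2).mono (by simp) (by simp)
  · simpa using hA
  · rw [dickson_add_two]
    simp only [map_sub, map_mul, aeval_X, aeval_C, Algebra.algebraMap_eq_smul_one, Matrix.smul_mul,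
      Matrix.one_mul]
    exact ((hA.mul (ih (j + 1) (by omega))).mono (by ring_nf; rfl) (by ring_nf; rfl)).sub
      (((ih j (by omega)).smul κ).mono (Nat.mul_le_mul_right _ (by omega))
        (Nat.mul_le_mul_right _ (by omega)))

theorem IsBanded.apply_eq_zero_of_lt_xi (hβ : 0 < β) (hγ : 0 < γ) {j : ℕ}
    (hA : IsBanded (j * β) (j * γ) A) {k l : Fin n} (hj : j < xi β γ k l) : A k l = 0 := by
  refine hA k l ?_
  unfold xi at hj
  split_ifs at hj with h
  · left
    rw [Nat.lt_ceil, lt_div_iff₀ (by exact_mod_cast hβ)] at hj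
    have : ((j * β : ℕ) : ℚ) < (((l : ℕ) : ℤ) - ((k : ℕ) : ℤ) : ℤ) := by push_cast; exact hj
    exact_mod_cast this
  · right
    rw [Nat.lt_ceil, lt_div_iff₀ (by exact_mod_cast hγ)] at hj
    have : ((j * γ : ℕ) : ℚ) < (((k : ℕ) : ℤ) - ((l : ℕ) : ℤ) : ℤ) := by push_cast; exact hj
    exact_mod_cast this

end Banded

/-! ### Summation of the surviving terms. -/

section TailSum

theorem hasSum_mul_of_nonneg {f g : ℕ → ℝ} {a b : ℝ} (hf : HasSum f a) (hg : HasSum g b)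
    (hf0 : ∀ m, 0 ≤ f m) (hg0 : ∀ m, 0 ≤ g m) :
    HasSum (fun x : ℕ × ℕ => f x.1 * g x.2) (a * b) :=
  HasSum.mul hf hg (hf.summable.mul_of_nonneg hg.summable hf0 hg0)

/-- The sum of the terms `σ ^ (p + q) * κ ^ min p q` with `|p - q| ≥ ξ` is majorized. -/
theorem exists_hasSum_tail {σ κ : ℝ} (hσ : 0 ≤ σ) (hσ1 : σ < 1) (hκ : 0 ≤ κ) (hκ1 : κ < 1) (ξ : ℕ) :
    ∃ S : ℕ × ℕ → ℝ, HasSum S (2 * (σ ^ ξ / ((1 - σ) * (1 - κ * σ ^ 2)))) ∧ (∀ x, 0 ≤ S x) ∧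
      ∀ x : ℕ × ℕ, ξ ≤ (x.1 - x.2) + (x.2 - x.1) → σ ^ (x.1 + x.2) * κ ^ (min x.1 x.2) ≤ S x := by
  -- T covers the pairs with p ≥ q + ξ, summed via p = q + ξ + m; its mirror image covers the rest.
  -- For ξ = 0 the diagonal is counted twice, hence only a majorant.
  obtain ⟨T, hT⟩ : ∃ T : ℕ × ℕ → ℝ, ∀ x, T x =
    if x.2 + ξ ≤ x.1 then σ ^ (x.1 + x.2) * κ ^ x.2 else 0 := ⟨_, fun _ => rfl⟩
  have hT0 : ∀ x, 0 ≤ T x := fun x => by rw [hT]; split_ifs <;> positivity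
  have hinj : Function.Injective (fun x : ℕ × ℕ => (x.1 + ξ + x.2, x.1)) := fun x y h => by
    simp only [Prod.mk.injEq] at h
    ext <;> omega
  have hκσ : κ * σ ^ 2 < 1 := by nlinarith [pow_le_one₀ (n := 2) hσ hσ1.le]
  have hTsum : HasSum T (σ ^ ξ / ((1 - σ) * (1 - κ * σ ^ 2))) := by
    rw [← hinj.hasSum_iff]
    · have h1 : HasSum (fun m => (κ * σ ^ 2) ^ m) (1 - κ * σ ^ 2)⁻¹ :=
        hasSum_geometric_of_lt_one (by positivity) hκσ
      have h2 : HasSum (fun m => σ ^ ξ * σ ^ m) (σ ^ ξ * (1 - σ)⁻¹) :=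
        (hasSum_geometric_of_lt_one hσ hσ1).mul_left (σ ^ ξ)
      have h3 := hasSum_mul_of_nonneg h1 h2 (fun _ => by positivity) fun _ => by positivity
      have e1 : (T ∘ fun x : ℕ × ℕ => (x.1 + ξ + x.2, x.1)) =
          fun x : ℕ × ℕ => (κ * σ ^ 2) ^ x.1 * (σ ^ ξ * σ ^ x.2) := by
        funext x
        rw [Function.comp_apply, hT, if_pos (Nat.le_add_right _ _), mul_pow, ← pow_mul]
        ring
      have e2 : σ ^ ξ / ((1 - σ) * (1 - κ * σ ^ 2)) =
          (1 - κ * σ ^ 2)⁻¹ * (σ ^ ξ * (1 - σ)⁻¹) := by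
        rw [div_eq_mul_inv, mul_inv]; ring
      rw [e1, e2]
      exact h3
    · intro x hx
      rw [hT]
      refine if_neg fun h => hx ⟨(x.2, x.1 - (x.2 + ξ)), ?_⟩
      ext
      · simp only; omega
      · rfl
  have hTsum' : HasSum (fun x : ℕ × ℕ => T (x.2, x.1)) (σ ^ ξ / ((1 - σ) * (1 - κ * σ ^ 2))) :=
    (Equiv.prodComm ℕ ℕ).hasSum_iff.2 hTsum
  refine ⟨fun x => T x + T (x.2, x.1), by rw [two_mul]; exact hTsum.add hTsum',
    fun x => add_nonneg (hT0 _) (hT0 _), fun x hx => ?_⟩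
  rcases le_total x.1 x.2 with h | h
  · refine le_trans (le_of_eq ?_) (le_add_of_nonneg_left (hT0 x))
    have h' : x.1 + ξ ≤ x.2 := by omega
    rw [hT, min_eq_left h, if_pos h', add_comm x.1]
  · refine le_trans (le_of_eq ?_) (le_add_of_nonneg_right (hT0 _))
    have h' : x.2 + ξ ≤ x.1 := by omega
    rw [hT, min_eq_right h, if_pos h']

end TailSum

/-! ### Admissibility of the elliptical contour. -/

section Ellipse

variable {c : ℂ} {R κ r : ℝ}

/-- Since Re c > 0, a point of (-∞,0] is horizontally at least as far from c as 0 is, at the same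
height. If it were in the ellipse of parameter r, so would be 0, contradicting r < |w₁|. -/
theorem lt_norm_or_lt_norm_of_notMem_slitPlane (hκ : 0 ≤ κ) (hκ1 : κ < 1)
    (hc : 0 < c.re) {w₁ w₂ : ℂ} (hadd : w₁ + w₂ = -c / R) (hmul : w₁ * w₂ = κ) (hr : 1 ≤ r)
    (hrw : r < ‖w₁‖) {p v₁ v₂ : ℂ} (hp : p ∉ Complex.slitPlane) (hvadd : v₁ + v₂ = (p - c) / R)
    (hvmul : v₁ * v₂ = κ) : r < ‖v₁‖ ∨ r < ‖v₂‖ := by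
  by_contra! h
  have h1 := mem_joukowskiRegion hκ hκ1 hr hvadd hvmul h.1 h.2
  rw [Complex.mem_slitPlane_iff] at hp
  push Not at hp
  have h2 : -c / R ∈ joukowskiRegion κ r := by
    refine joukowskiRegion_mono h1 ?_ ?_
    · rw [Complex.div_ofReal_re, Complex.div_ofReal_re, abs_div, abs_div]
      refine div_le_div_of_nonneg_right ?_ (abs_nonneg _)
      have h3 : p.re - c.re ≤ 0 := by linarith
      rw [Complex.neg_re, Complex.sub_re, abs_neg, abs_of_pos hc, abs_of_nonpos h3]
      linarith
    · rw [Complex.div_ofReal_im, Complex.div_ofReal_im, Complex.neg_im, Complex.sub_im, hp.2,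
        zero_sub]
  exact absurd (norm_le_of_mem_joukowskiRegion hκ hκ1 hr hadd hmul h2) (not_le.2 hrw)

theorem joukowski_sub_div (hR : 0 < R) (w : ℂ) : (joukowski c R κ w - c) / R = w + κ / w := by
  have hR0 : (R : ℂ) ≠ 0 := by exact_mod_cast hR.ne'
  rw [joukowski]
  field_simp
  ring

theorem norm_div_lt (hκ : 0 ≤ κ) (hκ1 : κ < 1) {u v : ℂ} (hmul : u * v = κ) (hr : 1 ≤ r)
    (hu : r < ‖u‖) : ‖v‖ < r := by
  have hnorm : ‖u‖ * ‖v‖ = κ := by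
    rw [← norm_mul, hmul, Complex.norm_real, Real.norm_of_nonneg hκ]
  by_contra! h
  nlinarith

theorem joukowski_mem_slitPlane (hR : 0 < R) (hκ : 0 ≤ κ) (hκ1 : κ < 1)
    (hc : 0 < c.re) {w₁ w₂ : ℂ} (hadd : w₁ + w₂ = -c / R) (hmul : w₁ * w₂ = κ) (hr : 1 ≤ r)
    (hrw : r < ‖w₁‖) {w : ℂ} (hw : ‖w‖ = r) : joukowski c R κ w ∈ Complex.slitPlane := by
  by_contra h
  have hw0 : w ≠ 0 := norm_pos_iff.1 (by rw [hw]; linarith)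
  have hv : w * (κ / w) = κ := by field_simp
  rcases lt_norm_or_lt_norm_of_notMem_slitPlane hκ hκ1 hc hadd hmul hr hrw h
    (joukowski_sub_div hR w).symm hv with h1 | h1
  · exact h1.ne' hw
  · have := norm_div_lt hκ hκ1 (by rwa [mul_comm] at hv) hr h1
    exact this.ne hw

/-- Points of K have both preimages in the closed unit disc, giving 1 + 1 - 1 = 1; points off the
slit plane have one inside |w| = r and one outside, giving 0 + 1 - 1 = 0. -/
theorem ellipseContour_encircles (hR : 0 < R) (hκ : 0 ≤ κ) (hκ1 : κ < 1)
    (hc : 0 < c.re) {w₁ w₂ : ℂ} (hadd : w₁ + w₂ = -c / R) (hmul : w₁ * w₂ = κ) (hr0 : 0 < r)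
    (hr : 1 < r) (hrw : r < ‖w₁‖) {K : Set ℂ} (hK : ∀ p ∈ K, (p - c) / R ∈ joukowskiRegion κ 1) :
    (ellipseContour c R κ hr0).Encircles Complex.slitPlane K := by
  refine ⟨fun z hz => ⟨?_, fun hzK => ?_⟩, fun p hp => ?_, fun p hp => ?_⟩
  · obtain ⟨w, hw, rfl⟩ := mem_trace_ellipseContour c R κ hr0 hz
    exact joukowski_mem_slitPlane hR hκ hκ1 hc hadd hmul hr.le hrw hw
  · obtain ⟨w, hw, rfl⟩ := mem_trace_ellipseContour c R κ hr0 hz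
    have hw0 : w ≠ 0 := norm_pos_iff.1 (by rwa [hw])
    have := norm_le_of_mem_joukowskiRegion hκ hκ1 le_rfl (joukowski_sub_div hR w).symm
      (by field_simp : w * (κ / w) = κ) (hK _ hzK)
    linarith
  · obtain ⟨u₁, u₂, hu, hu', -⟩ := exists_add_eq_mul_eq ((p - c) / R) κ
    have h1 := norm_le_of_mem_joukowskiRegion hκ hκ1 le_rfl hu hu' (hK _ hp)
    have h2 := norm_le_of_mem_joukowskiRegion hκ hκ1 le_rfl (by rwa [add_comm] at hu)
      (by rwa [mul_comm] at hu') (hK _ hp)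
    rw [windingNumber_ellipseContour c R κ hr0 hR hu hu' (by linarith) (by linarith),
      circleIntegral.integral_sub_inv_of_mem_ball (mem_ball_zero_iff.2 (by linarith)),
      circleIntegral.integral_sub_inv_of_mem_ball (mem_ball_zero_iff.2 (by linarith)), mul_add,
      inv_mul_cancel₀ two_pi_I_ne_zero]
    ring
  · obtain ⟨u₁, u₂, hu, hu', hle⟩ := exists_add_eq_mul_eq ((p - c) / R) κ
    have h1 : r < ‖u₁‖ := by
      rcases lt_norm_or_lt_norm_of_notMem_slitPlane hκ hκ1 hc hadd hmul hr.le hrw hp hu hu'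
        with h | h
      · exact h
      · exact h.trans_le hle
    have h2 := norm_div_lt hκ hκ1 hu' hr.le h1
    rw [windingNumber_ellipseContour c R κ hr0 hR hu hu' h1.ne' h2.ne,
      circleIntegral_sub_inv_of_lt hr0 h1,
      circleIntegral.integral_sub_inv_of_mem_ball (mem_ball_zero_iff.2 h2), zero_add,
      inv_mul_cancel₀ two_pi_I_ne_zero, sub_self]

end Ellipse

/-! ### The field of values in normalized coordinates. -/

section FieldOfValues

variable {n : ℕ} {A : Matrix (Fin n) (Fin n) ℂ}

theorem dotProduct_mulVec_mem {c : ℂ} {R κ : ℝ} (hR : 0 < R)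
    (hW : fieldOfValues A ⊆ ellipseRegion (R * (1 + κ)) (R * (1 - κ)) c) (v : Fin n → ℂ) :
    ∃ m ∈ joukowskiRegion κ 1,
      star v ⬝ᵥ (((R : ℂ)⁻¹ • (A - c • (1 : Matrix (Fin n) (Fin n) ℂ))) *ᵥ v) =
        m * (star v ⬝ᵥ v) := by
  have hR0 : (R : ℂ) ≠ 0 := by exact_mod_cast hR.ne'
  rcases eq_or_ne v 0 with rfl | hv
  · exact ⟨0, by simp [joukowskiRegion], by simp⟩
  set x : EuclideanSpace ℂ (Fin n) := WithLp.toLp 2 v with hx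
  have hxv : x.ofLp = v := rfl
  have hx0 : x ≠ 0 := fun h => hv (by rw [← hxv, h]; rfl)
  have hN : (‖x‖ : ℂ) ≠ 0 := by simpa using hx0
  have hvv : star v ⬝ᵥ v = (‖x‖ : ℂ) ^ 2 := by
    have h1 := inner_self_eq_norm_sq_to_K (𝕜 := ℂ) x
    rw [EuclideanSpace.inner_eq_star_dotProduct] at h1
    rw [dotProduct_comm]
    exact h1
  set y : EuclideanSpace ℂ (Fin n) := (‖x‖ : ℂ)⁻¹ • x with hy
  have hyv : y.ofLp = (‖x‖ : ℂ)⁻¹ • v := rfl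
  have hy1 : ‖y‖ = 1 := by
    rw [hy, norm_smul, norm_inv, Complex.norm_real, norm_norm]
    exact inv_mul_cancel₀ (norm_ne_zero_iff.2 hx0)
  have hz := hW ⟨y, hy1, rfl⟩
  have hval : star v ⬝ᵥ (A *ᵥ v) = (star y.ofLp ⬝ᵥ (A *ᵥ y.ofLp)) * (star v ⬝ᵥ v) := by
    rw [hvv, hyv, star_smul, Matrix.mulVec_smul, smul_dotProduct, dotProduct_smul]
    simp only [smul_eq_mul, RCLike.star_def, map_inv₀, Complex.conj_ofReal]
    field_simp
  set z := star y.ofLp ⬝ᵥ (A *ᵥ y.ofLp)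
  refine ⟨(z - c) / R, ?_, ?_⟩
  · have h1 : ((z.re - c.re) / (R * (1 + κ))) ^ 2 + ((z.im - c.im) / (R * (1 - κ))) ^ 2 ≤ 1 := hz
    simpa [joukowskiRegion, div_div] using h1
  · rw [Matrix.smul_mulVec, Matrix.sub_mulVec, Matrix.smul_mulVec, Matrix.one_mulVec,
      dotProduct_smul, dotProduct_sub, dotProduct_smul, hval]
    simp only [smul_eq_mul]
    field_simp

theorem spectrum_mem {c : ℂ} {R κ : ℝ} (hR : 0 < R)
    (hW : fieldOfValues A ⊆ ellipseRegion (R * (1 + κ)) (R * (1 - κ)) c) {p : ℂ}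
    (hp : p ∈ spectrum ℂ A) : (p - c) / R ∈ joukowskiRegion κ 1 := by
  have hR0 : (R : ℂ) ≠ 0 := by exact_mod_cast hR.ne'
  have hdet : (p • (1 : Matrix (Fin n) (Fin n) ℂ) - A).det = 0 := by
    by_contra h
    rw [spectrum.mem_iff, Algebra.algebraMap_eq_smul_one] at hp
    exact hp ((Matrix.isUnit_iff_isUnit_det _).2 (isUnit_iff_ne_zero.2 h))
  obtain ⟨v, hv, hv0⟩ := Matrix.exists_mulVec_eq_zero_iff.2 hdet
  rw [Matrix.sub_mulVec, Matrix.smul_mulVec, Matrix.one_mulVec, sub_eq_zero] at hv0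
  obtain ⟨m, hm, hmv⟩ := dotProduct_mulVec_mem hR hW v
  rw [Matrix.smul_mulVec, Matrix.sub_mulVec, Matrix.smul_mulVec, Matrix.one_mulVec, ← hv0,
    ← sub_smul, dotProduct_smul, dotProduct_smul, smul_eq_mul, smul_eq_mul, ← mul_assoc] at hmv
  have hvv : star v ⬝ᵥ v ≠ 0 := by
    open ComplexOrder in exact dotProduct_star_self_eq_zero.not.2 hv
  rw [← mul_right_cancel₀ hvv hmv] at hm
  rwa [div_eq_inv_mul]

end FieldOfValues

end MatrixDecay

namespace MatrixDecay

open Set Polynomial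

theorem Contour.isCompact_trace (Γ : Contour) : IsCompact Γ.trace :=
  isCompact_iUnion fun i => isCompact_Icc.image_of_continuousOn (Γ.contDiffOn i).continuousOn

theorem differentiableOn_inv_sqrt :
    DifferentiableOn ℂ (fun z => (Complex.sqrt z)⁻¹) Complex.slitPlane := fun z hz => by
  have h0 : Complex.sqrt z ≠ 0 := fun h => by simpa [h] using sqrt_re_pos hz
  exact ((hasDerivAt_sqrt hz).differentiableAt.inv h0).differentiableWithinAt

/-! ### The series for the inverse square root of A and its entrywise bound. -/

section Expansion

variable {n : ℕ} {A : Matrix (Fin n) (Fin n) ℂ} {c : ℂ} {R κ r : ℝ}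

theorem exists_hasSum_resolventIntegral_inv_sqrt (hR : 0 < R) (hκ : 0 ≤ κ) (hκ1 : κ < 1)
    (hc : 0 < c.re) {w₁ w₂ : ℂ} (hadd : w₁ + w₂ = -c / R) (hmul : w₁ * w₂ = κ) (hr0 : 0 < r)
    (hr : 1 < r) (hrw : r < ‖w₁‖) (hK : ∀ p ∈ spectrum ℂ A, (p - c) / R ∈ joukowskiRegion κ 1) :
    ∃ (C : ℂ) (α : ℕ → ℂ), ‖C‖ ^ 2 * (R * ‖w₁‖) = 1 ∧ (∀ m, ‖α m‖ ≤ 1) ∧ ∀ k l,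
      HasSum (fun x : ℕ × ℕ => C * (α x.1 * α x.2 / 2) *
        ((w₁⁻¹) ^ (x.1 + x.2) * (κ : ℂ) ^ (min x.1 x.2)) *
          (aeval ((R : ℂ)⁻¹ • (A - c • (1 : Matrix (Fin n) (Fin n) ℂ)))
            (dickson 1 (κ : ℂ) ((x.1 - x.2) + (x.2 - x.1)))) k l)
        (resolventIntegral (ellipseContour c R κ hr0) A (fun z => (Complex.sqrt z)⁻¹) k l) := by
  have hw₁ : w₁ ≠ 0 := norm_pos_iff.1 (hr0.trans hrw)
  have hw₂ : ‖w₂‖ < r := norm_div_lt hκ hκ1 hmul hr.le hrw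
  obtain ⟨C, α, hC, hα, hsum⟩ := exists_hasSum_inv_sqrt hR hr0 hadd hmul hrw hw₂
    fun w hw => joukowski_mem_slitPlane hR hκ hκ1 hc hadd hmul hr.le hrw hw
  refine ⟨C, α, hC, hα, fun k l => ?_⟩
  have hΓ := ellipseContour_encircles hR hκ hκ1 hc hadd hmul hr0 hr hrw hK
  set Γ := ellipseContour c R κ hr0 with hΓdef
  have hdis : Disjoint Γ.trace (spectrum ℂ A) := (subset_sdiff.1 hΓ.1).2
  have hres := continuousOn_resolvent hdis k l
  obtain ⟨B, hB⟩ := Γ.isCompact_trace.exists_bound_of_continuousOn hres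
  set coef : ℕ × ℕ → ℂ := fun x => C * (α x.1 * α x.2 / 2) *
    ((w₁⁻¹) ^ (x.1 + x.2) * (κ : ℂ) ^ (min x.1 x.2)) with hcoef
  set D : ℕ × ℕ → ℂ[X] := fun x => dickson 1 (κ : ℂ) ((x.1 - x.2) + (x.2 - x.1)) with hD
  set F : ℕ × ℕ → ℂ → ℂ := fun x z => coef x * (D x).eval ((R : ℂ)⁻¹ * (z - c)) *
    ((z • (1 : Matrix (Fin n) (Fin n) ℂ) - A)⁻¹) k l with hF
  have harg : ∀ w, (R : ℂ)⁻¹ * (joukowski c R κ w - c) = w + κ / w := fun w => by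
    rw [← div_eq_inv_mul, joukowski_sub_div hR]
  -- On |w| = r the two geometric ratios are ρ and σ, both below 1; they give the summable majorant
  -- for termwise integration.
  set ρ := r / ‖w₁‖ with hρ
  set σ := ‖w₂‖ / r with hσ
  have hρ0 : 0 ≤ ρ := by positivity
  have hρ1 : ρ < 1 := (div_lt_one (hr0.trans hrw)).2 hrw
  have hσ0 : 0 ≤ σ := by positivity
  have hσ1 : σ < 1 := (div_lt_one hr0).2 hw₂
  have hsummable : Summable fun x : ℕ × ℕ => ρ ^ x.1 * σ ^ x.2 + ρ ^ x.2 * σ ^ x.1 := by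
    have h1 : HasSum (fun x : ℕ × ℕ => ρ ^ x.1 * σ ^ x.2) ((1 - ρ)⁻¹ * (1 - σ)⁻¹) :=
      hasSum_mul_of_nonneg (hasSum_geometric_of_lt_one hρ0 hρ1)
        (hasSum_geometric_of_lt_one hσ0 hσ1) (fun _ => by positivity) fun _ => by positivity
    have h2 : HasSum (fun x : ℕ × ℕ => ρ ^ x.2 * σ ^ x.1) ((1 - ρ)⁻¹ * (1 - σ)⁻¹) :=
      (Equiv.prodComm ℕ ℕ).hasSum_iff.2 h1
    exact (h1.add h2).summable
  have hmain : HasSum (fun x => Γ.integral (F x)) (Γ.integral fun z => (Complex.sqrt z)⁻¹ *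
      ((z • (1 : Matrix (Fin n) (Fin n) ℂ) - A)⁻¹) k l) := by
    refine Γ.hasSum_integral (bound := fun x => ‖C‖ * (ρ ^ x.1 * σ ^ x.2 + ρ ^ x.2 * σ ^ x.1) * B)
      (fun x => ?_) (fun x z hz => ?_) ((hsummable.mul_left ‖C‖).mul_right B) (fun z hz => ?_)
    · refine ContinuousOn.mul (continuousOn_const.mul ?_) hres
      exact ((D x).continuous.comp (by fun_prop : Continuous fun z : ℂ => (R : ℂ)⁻¹ * (z - c))).continuousOn
    · have hBz := hB z hz
      obtain ⟨w, hw, rfl⟩ := mem_trace_ellipseContour c R κ hr0 hz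
      have hw0 : w ≠ 0 := norm_pos_iff.1 (by rwa [hw])
      have e1 : coef x * (D x).eval (w + κ / w) = C * (α x.1 * α x.2 / 2) *
          ((w / w₁) ^ x.1 * (w₂ / w) ^ x.2 + (w / w₁) ^ x.2 * (w₂ / w) ^ x.1) := by
        rw [← mul_eval_dickson hw0 hw₁ hmul]
        simp only [hcoef, hD, mul_assoc]
      have e2 : ‖C * (α x.1 * α x.2 / 2)‖ ≤ ‖C‖ := by
        rw [norm_mul, norm_div, norm_mul]
        refine mul_le_of_le_one_right (norm_nonneg _) ?_
        have := mul_le_one₀ (hα x.1) (norm_nonneg _) (hα x.2)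
        simp only [Complex.norm_ofNat]
        linarith
      have e3 : ‖(w / w₁) ^ x.1 * (w₂ / w) ^ x.2 + (w / w₁) ^ x.2 * (w₂ / w) ^ x.1‖ ≤
          ρ ^ x.1 * σ ^ x.2 + ρ ^ x.2 * σ ^ x.1 := by
        refine (norm_add_le _ _).trans_eq ?_
        simp only [norm_mul, norm_pow, norm_div, hw, hρ, hσ]
      simp only [hF]
      rw [harg, e1, norm_mul, norm_mul]
      gcongr
    · obtain ⟨w, hw, rfl⟩ := mem_trace_ellipseContour c R κ hr0 hz
      refine HasSum.mul_right _ ?_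
      have h := hsum w hw
      rw [← harg w] at h
      simpa only [hcoef, hD, mul_assoc] using h
  have hmain' := hmain.mul_left (2 * Real.pi * Complex.I : ℂ)⁻¹
  have hterm : ∀ x, (2 * Real.pi * Complex.I : ℂ)⁻¹ * Γ.integral (F x) = coef x *
      (aeval ((R : ℂ)⁻¹ • (A - c • (1 : Matrix (Fin n) (Fin n) ℂ))) (D x)) k l := fun x => by
    rw [← resolventIntegral_eval hΓ c (R : ℂ)⁻¹ (D x), ← smul_eq_mul (coef x),
      ← Matrix.smul_apply, ← resolventIntegral_const_mul]
    rfl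
  simp only [hterm] at hmain'
  exact hmain'

theorem norm_le_of_isInvSqrt (hR : 0 < R) (hκ : 0 ≤ κ) (hκ1 : κ < 1)
    (hW : fieldOfValues A ⊆ ellipseRegion (R * (1 + κ)) (R * (1 - κ)) c)
    (hspec : spectrum ℂ A ⊆ Complex.slitPlane) (hc : 0 < c.re) {w₁ w₂ : ℂ}
    (hadd : w₁ + w₂ = -c / R) (hmul : w₁ * w₂ = κ) (hw₁ : 1 < ‖w₁‖) {β γ : ℕ} (hβ : 0 < β)
    (hγ : 0 < γ) (hA : IsBanded β γ A) {X : Matrix (Fin n) (Fin n) ℂ} (hX : IsInvSqrt A X)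
    (k l : Fin n) :
    ‖X k l‖ ≤ (Real.sqrt (R * ‖w₁‖))⁻¹ * (2 * ((‖w₁‖⁻¹) ^ (xi β γ k l) /
      ((1 - ‖w₁‖⁻¹) * (1 - κ * (‖w₁‖⁻¹) ^ 2)))) := by
  obtain ⟨r, hr, hrw⟩ := exists_between hw₁
  have hr0 : 0 < r := zero_lt_one.trans hr
  have hK := fun p (hp : p ∈ spectrum ℂ A) => spectrum_mem hR hW hp
  obtain ⟨C, α, hC, hα, hsum⟩ :=
    exists_hasSum_resolventIntegral_inv_sqrt hR hκ hκ1 hc hadd hmul hr0 hr hrw hK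
  obtain ⟨B, hB⟩ := exists_eq_resolventIntegral hspec differentiableOn_inv_sqrt
  obtain ⟨-, -, Γ, hΓ, hXΓ⟩ := hX
  have hXeq : X = resolventIntegral Γ A fun z => (Complex.sqrt z)⁻¹ := by
    ext i j
    exact hXΓ i j
  rw [hB _ hΓ, ← hB _ (ellipseContour_encircles hR hκ hκ1 hc hadd hmul hr0 hr hrw hK)] at hXeq
  have hs := hsum k l
  rw [← hXeq] at hs
  have hCnorm : ‖C‖ = (Real.sqrt (R * ‖w₁‖))⁻¹ := by
    have hpos : 0 < R * ‖w₁‖ := mul_pos hR (by linarith)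
    rw [← Real.sqrt_inv, ← eq_inv_of_mul_eq_one_left hC, Real.sqrt_sq (norm_nonneg _)]
  obtain ⟨S, hS, hS0, hSle⟩ := exists_hasSum_tail (σ := ‖w₁‖⁻¹) (κ := κ) (by positivity)
    (inv_lt_one_of_one_lt₀ hw₁) hκ hκ1 (xi β γ k l)
  rw [← hCnorm]
  refine hs.norm_le_of_bounded (hS.mul_left ‖C‖) fun x => ?_
  have hband := (((hA.sub ((isBanded_one.smul c).mono (Nat.zero_le β) (Nat.zero_le γ))).smul
    ((R : ℂ)⁻¹)).aeval_dickson (κ : ℂ) ((x.1 - x.2) + (x.2 - x.1)))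
  rcases lt_or_ge ((x.1 - x.2) + (x.2 - x.1)) (xi β γ k l) with h | h
  · rw [hband.apply_eq_zero_of_lt_xi hβ hγ h, mul_zero, norm_zero]
    exact mul_nonneg (norm_nonneg _) (hS0 x)
  · have hD := norm_aeval_dickson_le hκ hκ1 (dotProduct_mulVec_mem hR hW)
      ((x.1 - x.2) + (x.2 - x.1)) k l
    have hα' := mul_le_one₀ (hα x.1) (norm_nonneg _) (hα x.2)
    have hSx := hSle x h
    rw [norm_mul, norm_mul, norm_mul, norm_mul, norm_div, norm_mul, norm_pow, norm_pow, norm_inv,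
      Complex.norm_real, Real.norm_of_nonneg hκ, Complex.norm_ofNat]
    -- The factor 1/2 from symmetrization cancels the bound 2 on the Dickson entries.
    calc ‖C‖ * (‖α x.1‖ * ‖α x.2‖ / 2) * ((‖w₁‖⁻¹) ^ (x.1 + x.2) * κ ^ (min x.1 x.2)) * _
        ≤ ‖C‖ * (1 / 2) * ((‖w₁‖⁻¹) ^ (x.1 + x.2) * κ ^ (min x.1 x.2)) * 2 := by gcongr
      _ = ‖C‖ * ((‖w₁‖⁻¹) ^ (x.1 + x.2) * κ ^ (min x.1 x.2)) := by ring
      _ ≤ ‖C‖ * S x := by gcongr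

end Expansion

/-! ### The quantities of the theorem in terms of the exterior preimage. -/

section Radius

variable {a b ε : ℝ} {c : ℂ}

theorem rate_eq (hε : ε < ‖c‖) (hc : 0 < c.re) :
    rate a b c ε = (a + b) / levelRadius a b c ε := by
  have hc0 : 0 < ‖c‖ := norm_pos_iff.2 fun h => by simp [h] at hc
  have ht : 0 < 1 - ε / ‖c‖ := sub_pos.2 ((div_lt_one hc0).2 hε)
  have hz : c * (1 - ε / ‖c‖) = c * ((1 - ε / ‖c‖ : ℝ) : ℂ) := by push_cast; rfl
  have hre : 0 < (c * (1 - ε / ‖c‖)).re := by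
    rw [hz, Complex.re_mul_ofReal]; exact mul_pos hc ht
  have hnorm : ‖c * (1 - ε / ‖c‖)‖ = ‖c‖ - ε := by
    rw [hz, norm_mul, Complex.norm_real, Real.norm_of_nonneg ht.le]
    field_simp
  have h := norm_mul_one_add_sqrt (a ^ 2 - b ^ 2) hre
  rw [hnorm] at h
  push_cast at h
  rw [mul_pow c] at h
  rw [rate, levelRadius, ← h, mul_pow c, mul_one_div, div_div]

theorem exists_levelRadius_eq (hab : 0 < a + b) (hε : ε < ‖c‖) (hc : 0 < c.re) :
    ∃ u₁ u₂ : ℂ, u₁ + u₂ = c * (1 - ε / ‖c‖ : ℝ) / ((a + b) / 2 : ℝ) ∧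
      u₁ * u₂ = ((a - b) / (a + b) : ℝ) ∧ ‖u₂‖ ≤ ‖u₁‖ ∧ levelRadius a b c ε = (a + b) * ‖u₁‖ := by
  have hc0 : 0 < ‖c‖ := norm_pos_iff.2 fun h => by simp [h] at hc
  have ht : 0 < 1 - ε / ‖c‖ := sub_pos.2 ((div_lt_one hc0).2 hε)
  set t : ℝ := 1 - ε / ‖c‖ with htdef
  have hre : 0 < (c * t).re := by rw [Complex.re_mul_ofReal]; exact mul_pos hc ht
  have h := sqrt_sq ((c * t) ^ 2 - ((a ^ 2 - b ^ 2 : ℝ) : ℂ))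
  have hle := norm_sub_sqrt_le (a ^ 2 - b ^ 2) hre
  have hlev : levelRadius a b c ε = ‖c * t + Complex.sqrt ((c * t) ^ 2 - (a ^ 2 - b ^ 2 : ℝ))‖ := by
    rw [levelRadius, mul_pow, htdef]
    push_cast
    rfl
  set S := Complex.sqrt ((c * t) ^ 2 - ((a ^ 2 - b ^ 2 : ℝ) : ℂ))
  have hab0 : ((a + b : ℝ) : ℂ) ≠ 0 := by exact_mod_cast hab.ne'
  refine ⟨(c * t + S) / (a + b : ℝ), (c * t - S) / (a + b : ℝ), ?_, ?_, ?_, ?_⟩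
  · rw [Complex.ofReal_div (a + b), Complex.ofReal_ofNat]
    field_simp
    ring
  · rw [div_mul_div_comm, Complex.ofReal_div, div_eq_div_iff (mul_ne_zero hab0 hab0) hab0]
    push_cast at h ⊢
    linear_combination -(a + b : ℂ) * h
  · rw [norm_div, norm_div]
    gcongr
  · rw [hlev, norm_div, Complex.norm_real, Real.norm_of_nonneg hab.le]
    field_simp

/-- With τ = 1 + s, the difference of the two sides is a polynomial in s with nonnegative
coefficients over (1+s)³. For τ = |w₁| the left side times R is at least |c| - a, which dominates ε.
-/
theorem sub_le_mul_sq {κ τ : ℝ} (hκ : 0 ≤ κ) (hκ1 : κ < 1) (hτ : 1 ≤ τ) :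
    τ + κ / τ - (1 + κ) ≤ τ * (1 - κ * τ⁻¹ ^ 2) ^ 2 := by
  have hτ0 : 0 < τ := by linarith
  obtain ⟨s, hs, rfl⟩ : ∃ s, 0 ≤ s ∧ τ = 1 + s := ⟨τ - 1, by linarith, by ring⟩
  have h : (1 + s) * (1 - κ * (1 + s)⁻¹ ^ 2) ^ 2 - ((1 + s) + κ / (1 + s) - (1 + κ)) =
      ((1 - κ) ^ 2 + 3 * (1 - κ) * s + 3 * s ^ 2 + (1 + κ) * s ^ 3) / (1 + s) ^ 3 := by
    field_simp
    ring
  have h2 : 0 ≤ ((1 - κ) ^ 2 + 3 * (1 - κ) * s + 3 * s ^ 2 + (1 + κ) * s ^ 3) / (1 + s) ^ 3 := by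
    have : 0 ≤ 1 - κ := by linarith
    positivity
  linarith

end Radius

end MatrixDecay

/-! ### The decay bound. -/

theorem corollary3p4 {n β γ : ℕ} (hβ : 0 < β) (hγ : 0 < γ)
    (A : Matrix (Fin n) (Fin n) ℂ) (hA : MatrixDecay.IsBanded β γ A)
    (a b : ℝ) (c : ℂ) (hb : 0 < b) (hab : b ≤ a)
    (hE : ∀ z ∈ MatrixDecay.ellipseRegion a b c, 0 < z.re)
    (hW : MatrixDecay.fieldOfValues A ⊆ MatrixDecay.ellipseRegion a b c)
    (ε : ℝ) (hε : 0 < ε) (hεc : ε ≤ ‖c‖ - Real.sqrt (a * (a + b))) :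
    a + b < MatrixDecay.levelRadius a b c ε ∧
    MatrixDecay.rate a b c ε < 1 ∧
    (∃ X, MatrixDecay.IsInvSqrt A X) ∧
    ∀ X, MatrixDecay.IsInvSqrt A X → ∀ k l : Fin n,
      ‖X k l‖ ≤ 2 / Real.sqrt ε * MatrixDecay.q₂ a b c ε *
        MatrixDecay.rate a b c ε ^ MatrixDecay.xi β γ k l := by
  open MatrixDecay in
  have ha : 0 < a := hb.trans_le hab
  have hab0 : 0 < a + b := by linarith
  have hca : a < c.re := by
    -- The leftmost point of the ellipse.
    have h := hE (c - a) (by simp [ellipseRegion, ha.ne'])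
    simpa using h
  have hc : 0 < c.re := ha.trans hca
  -- Hence |c| - ε > a = R(1+κ), which puts both exterior preimages u₁ and w₁ outside the unit disc.
  have hsqrt : a < Real.sqrt (a * (a + b)) := Real.lt_sqrt_of_sq_lt (by nlinarith)
  have hεlt : ε < ‖c‖ := by linarith
  have hc0 : 0 < ‖c‖ := hε.trans hεlt
  obtain ⟨R, hR⟩ : ∃ R, R = (a + b) / 2 := ⟨_, rfl⟩
  obtain ⟨κ, hκ⟩ : ∃ κ, κ = (a - b) / (a + b) := ⟨_, rfl⟩
  have hR0 : 0 < R := by rw [hR]; linarith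
  have hκ0 : 0 ≤ κ := by rw [hκ]; exact div_nonneg (by linarith) hab0.le
  have hκ1 : κ < 1 := by rw [hκ, div_lt_one hab0]; linarith
  have haR : R * (1 + κ) = a := by rw [hR, hκ]; field_simp; ring
  have hbR : R * (1 - κ) = b := by rw [hR, hκ]; field_simp; ring
  obtain ⟨u₁, u₂, hu, hu', hule, hlev⟩ := exists_levelRadius_eq hab0 hεlt hc
  rw [← hR] at hu
  rw [← hκ] at hu'
  set t : ℝ := 1 - ε / ‖c‖ with ht
  have ht0 : 0 ≤ t := sub_nonneg.2 ((div_le_one hc0).2 hεlt.le)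
  have ht1 : t ≤ 1 := by rw [ht]; linarith [div_pos hε hc0]
  have hct : ‖c * t / R‖ = (‖c‖ - ε) / R := by
    rw [norm_div, norm_mul, Complex.norm_real, Complex.norm_real, Real.norm_of_nonneg ht0,
      Real.norm_of_nonneg hR0.le, ht]
    field_simp
  have hu1 : 1 < ‖u₁‖ := by
    refine one_lt_norm_of_lt_norm_add hκ0 hu hu' hule ?_
    rw [hct, lt_div_iff₀ hR0, mul_comm, haR]
    linarith
  obtain ⟨w₁, w₂, hw, hw', hwle⟩ := exists_add_eq_mul_eq (-c / R) κ
  have hcR : ‖-c / R‖ = ‖c‖ / R := by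
    rw [norm_div, norm_neg, Complex.norm_real, Real.norm_of_nonneg hR0.le]
  have hw1 : 1 < ‖w₁‖ := by
    refine one_lt_norm_of_lt_norm_add hκ0 hw hw' hwle ?_
    rw [hcR, lt_div_iff₀ hR0, mul_comm, haR]
    linarith
  -- The point c(1-ε/|c|)/R has coordinates no larger in modulus than those of -c/R, so it lies in
  -- the confocal ellipse through -c/R.
  have huw : ‖u₁‖ ≤ ‖w₁‖ := by
    refine norm_le_of_mem_joukowskiRegion hκ0 hκ1 hw1.le hu hu' (joukowskiRegion_mono
      (mem_joukowskiRegion hκ0 hκ1 hw1.le hw hw' le_rfl hwle) ?_ ?_)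
    · rw [Complex.div_ofReal_re, Complex.div_ofReal_re, Complex.re_mul_ofReal, Complex.neg_re,
        abs_div, abs_div, abs_mul, abs_neg, abs_of_nonneg ht0]
      exact div_le_div_of_nonneg_right (mul_le_of_le_one_right (abs_nonneg _) ht1) (abs_nonneg _)
    · rw [Complex.div_ofReal_im, Complex.div_ofReal_im, Complex.im_mul_ofReal, Complex.neg_im,
        abs_div, abs_div, abs_mul, abs_neg, abs_of_nonneg ht0]
      exact div_le_div_of_nonneg_right (mul_le_of_le_one_right (abs_nonneg _) ht1) (abs_nonneg _)
  have hW' : fieldOfValues A ⊆ ellipseRegion (R * (1 + κ)) (R * (1 - κ)) c := by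
    rwa [haR, hbR]
  have hspec : spectrum ℂ A ⊆ Complex.slitPlane := fun p hp => by
    refine Complex.mem_slitPlane_iff.2 (Or.inl (hE p ?_))
    have h := spectrum_mem hR0 hW' hp
    rw [← haR, ← hbR]
    simpa [joukowskiRegion, ellipseRegion, div_div] using h
  have hrate : rate a b c ε = ‖u₁‖⁻¹ := by
    rw [rate_eq hεlt hc, hlev]
    field_simp
  refine ⟨by rw [hlev]; exact lt_mul_of_one_lt_right hab0 hu1, ?_, ?_, fun X hX k l => ?_⟩
  · rw [hrate]
    exact inv_lt_one_of_one_lt₀ hu1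
  · obtain ⟨r, hr, hrw⟩ := exists_between hw1
    have hr0 : 0 < r := zero_lt_one.trans hr
    exact ⟨resolventIntegral (ellipseContour c R κ hr0) A fun z => (Complex.sqrt z)⁻¹,
      Complex.isOpen_slitPlane, differentiableOn_inv_sqrt, _,
      ellipseContour_encircles hR0 hκ0 hκ1 hc hw hw' hr0 hr hrw
        fun p hp => spectrum_mem hR0 hW' hp, fun _ _ => rfl⟩
  · refine (norm_le_of_isInvSqrt hR0 hκ0 hκ1 hW' hspec hc hw hw' hw1 hβ hγ hA hX k l).trans ?_
    have hq : q₂ a b c ε = (1 - ‖u₁‖⁻¹)⁻¹ := by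
      have h1 : ‖u₁‖ - 1 ≠ 0 := by linarith
      have h2 : (a + b) * ‖u₁‖ - (a + b) ≠ 0 := by
        rw [← mul_sub_one]; exact mul_ne_zero hab0.ne' h1
      rw [q₂, hlev]
      field_simp
    rw [hq, hrate]
    generalize xi β γ k l = ξ
    set τ := ‖w₁‖ with hτ
    have hτ0 : 0 < τ := by linarith
    have hσ1 : τ⁻¹ < 1 := inv_lt_one_of_one_lt₀ hw1
    have hu0 : ‖u₁‖⁻¹ < 1 := inv_lt_one_of_one_lt₀ hu1
    have hσu : τ⁻¹ ≤ ‖u₁‖⁻¹ := inv_anti₀ (by linarith) huw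
    have hκσ : 0 < 1 - κ * τ⁻¹ ^ 2 := by
      have : τ⁻¹ ^ 2 ≤ 1 := pow_le_one₀ (by positivity) hσ1.le
      nlinarith
    have hw2 : ‖w₂‖ = κ / τ := by
      rw [eq_div_iff hτ0.ne', mul_comm, hτ, ← norm_mul, hw', Complex.norm_real,
        Real.norm_of_nonneg hκ0]
    -- The triangle inequality gives |c|/R ≤ τ + κ/τ, so ε < |c| - a ≤ R(τ + κ/τ - (1+κ)).
    have hεR : ε ≤ R * τ * (1 - κ * τ⁻¹ ^ 2) ^ 2 := by
      have h1 := norm_add_le w₁ w₂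
      rw [hw, hcR, hw2, div_le_iff₀ hR0] at h1
      have h2 := mul_le_mul_of_nonneg_left (sub_le_mul_sq hκ0 hκ1 hw1.le) hR0.le
      rw [mul_assoc]
      refine le_trans ?_ h2
      rw [mul_sub, haR, mul_comm]
      linarith
    have hkey : (Real.sqrt (R * τ))⁻¹ * (1 - κ * τ⁻¹ ^ 2)⁻¹ ≤ (Real.sqrt ε)⁻¹ := by
      rw [← mul_inv]
      refine inv_anti₀ (Real.sqrt_pos.2 hε) ?_
      rw [← Real.sqrt_sq hκσ.le, ← Real.sqrt_mul (by positivity)]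
      exact Real.sqrt_le_sqrt hεR
    calc (Real.sqrt (R * τ))⁻¹ * (2 * (τ⁻¹ ^ ξ / ((1 - τ⁻¹) * (1 - κ * τ⁻¹ ^ 2))))
        = 2 * ((Real.sqrt (R * τ))⁻¹ * (1 - κ * τ⁻¹ ^ 2)⁻¹) * (1 - τ⁻¹)⁻¹ * τ⁻¹ ^ ξ := by
          rw [div_eq_mul_inv, mul_inv]; ring
      _ ≤ 2 * (Real.sqrt ε)⁻¹ * (1 - ‖u₁‖⁻¹)⁻¹ * ‖u₁‖⁻¹ ^ ξ := by
          have h1 : 0 < 1 - ‖u₁‖⁻¹ := by linarith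
          have h2 : 0 < 1 - τ⁻¹ := by linarith
          gcongr
      _ = _ := by rw [div_eq_mul_inv]
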